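/- Let $d$ be an odd positive integer. A function $f:\mathbb Z/d\mathbb Z\to\mathbb C$ is called $\lambda$-critical ($\lambda\in\mathbb C$) if $f\neq 0$ and $\sum_{s\in\mathbb Z/d\mathbb Z} f(s)f(2t-s)=\lambda f(t)^2$ for all $t\in\mathbb Z/d\mathbb Z$. For $\tau\in\mathbb H=\{\tau\in\mathbb C: \operatorname{Im}\tau>0\}$ let $\theta_\tau(z)=\sum_{m\in\mathbb Z}e^{i\pi\tau m^2}e^{2i\pi mz}$ $(z\in\mathbb C)$; $\theta_\tau$ is called $(\lambda,d)$-critical if for every $z\in\mathbb C$ the function $\ell\mapsto\theta_\tau(z+\ell/d)$ is $\lambda$-critical on $\mathbb Z/d\mathbb Z$. Call $(a,b)$ admissible if $a,b$ are positive integers with $a+b=d$ and $a\equiv\frac{(d+1)^2}{4}\pmod 4$; for such a pair put $$\lambda_0:=\sqrt a+i\sqrt b,\qquad \tau_0:=\frac{a-b-d^2+2i\sqrt{ab}}{4d^2}\in\mathbb H,\qquad N_k:=d^2|k+\tau_0|^2\quad(k\in\mathbb Z).$$ Then: (a) For every admissible pair $(a,b)$, $\theta_{\tau_0}$ is $(\lambda_0,d)$-critical.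 (b) Conversely, if $\tau\in\mathbb H$, $\lambda\in\mathbb C$ and $\theta_\tau$ is $(\lambda,d)$-critical, then $\lambda=\pm\sqrt a\pm i\sqrt b$ for some admissible pair $(a,b)$ and some choice of the two signs. (c) Let $(a,b)$ be admissible. All the $N_k$ are integers, and for $\tau\in\mathbb H$ the function $\theta_\tau$ is $(\lambda,d)$-critical for $\lambda=\lambda_0$ or $\lambda=-\lambda_0$ if and only if $\tau=(k+\tau_0)/p$ for some $k\in\mathbb Z$ and some positive divisor $p$ of $N_k$. (d) Let $(a,b)$ be admissible, $k\in\mathbb Z$, and $p>0$ a divisor of $N_k$. For $\tau=(k+\tau_0)/p$, the unique $\lambda$ such that $\theta_\tau$ is $(\lambda,d)$-critical is $\lambda=\varepsilon\lambda_0$, where $\varepsilon=\left(\frac{p}{4k-1}\right)\in\{1,-1\}$ is the Jacobi symbol, with the convention $\left(\frac{p}{n}\right)=\left(\frac{p}{-n}\right)$ for negative odd $n$. Moreover, for $\tau\in\mathbb H$ and $\lambda\in\mathbb C$, $\theta_\tau$ is $(\lambda,d)$-critical if and only if $\theta_{-\bar\tau}$ is $(\bar\lambda,d)$-critical, so that (a)–(d)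 describe all triples $(d,\lambda,\tau)$ with $d$ odd. -/

import Mathlib

open Complex

/-- `f : G → ℂ` is a `lam`-critical function on the finite abelian group `G`: it is non-zero and
its convolution square satisfies `(f ⋆ f)(2t) = lam * f(t)^2` for all `t`. -/
def IsCriticalFunction {G : Type*} [AddCommGroup G] [Fintype G] (lam : ℂ) (f : G → ℂ) : Prop :=
  f ≠ 0 ∧ ∀ t : G, ∑ s : G, f s * f (2 • t - s) = lam * f t ^ 2

/-- The function `f_{z,τ} : ℓ ↦ θ(z + ℓ/d, τ)` on `ℤ/dℤ`, where
`θ(z, τ) = ∑ m : ℤ, exp (π i τ m²) exp (2 π i m z)`. The representative in `{0, …, d - 1}` is used;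
any other one gives the same value, see `thetaSample_intCast`. -/
noncomputable def thetaSample (d : ℕ) (τ z : ℂ) (l : ZMod d) : ℂ :=
  jacobiTheta₂ (z + (l.val : ℂ) / (d : ℂ)) τ

theorem thetaSample_intCast (d : ℕ) [NeZero d] (τ z : ℂ) (n : ℤ) :
    thetaSample d τ z (n : ZMod d) = jacobiTheta₂ (z + (n : ℂ) / (d : ℂ)) τ := by
  have hd : (d : ℂ) ≠ 0 := Nat.cast_ne_zero.mpr (NeZero.ne d)
  have hper : ∀ (m : ℤ) (w : ℂ), jacobiTheta₂ (w + m) τ = jacobiTheta₂ w τ := by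
    intro m w
    have h : Function.Periodic (fun u : ℂ => jacobiTheta₂ u τ) 1 :=
      fun u => jacobiTheta₂_add_left u τ
    simpa using h.int_mul m w
  have hv : (((n : ZMod d).val : ℤ)) = n % d := ZMod.val_intCast n
  have hn : (n : ℂ) = (((n : ZMod d).val : ℕ) : ℂ) + (d : ℂ) * ((n / d : ℤ) : ℂ) := by
    have h := Int.emod_add_mul_ediv n d
    rw [← hv] at h
    exact_mod_cast h.symm
  rw [thetaSample, ← hper (n / d) (z + _)]
  congr 1
  rw [hn]
  field_simp
  ring

/-- `θ_τ` is `(lam, d)`-critical: for every `z`, the function `ℓ ↦ θ(z + ℓ/d, τ)` is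
`lam`-critical on `ℤ/dℤ`. -/
def IsThetaCritical (lam : ℂ) (d : ℕ) [NeZero d] (τ : ℂ) : Prop :=
  ∀ z : ℂ, IsCriticalFunction lam (thetaSample d τ z)

/-- The admissible pairs for odd `d`: positive integers with `a + b = d` and
`a ≡ (d + 1)² / 4 (mod 4)` (the division is exact since `d` is odd). -/
def IsAdmissiblePair (d a b : ℕ) : Prop :=
  0 < a ∧ 0 < b ∧ a + b = d ∧ a ≡ (d + 1) ^ 2 / 4 [MOD 4]

/-- The number `√a + i √b`. -/
noncomputable def lambdaZero (a b : ℕ) : ℂ := (√(a : ℝ) : ℂ) + I * (√(b : ℝ) : ℂ)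

/-- The fundamental parameter `τ₀ = (a - b - d² + 2 i √(ab)) / (4 d²)`. -/
noncomputable def tauZero (d a b : ℕ) : ℂ :=
  ((a : ℂ) - (b : ℂ) - (d : ℂ) ^ 2 + 2 * I * (√((a : ℝ) * (b : ℝ)) : ℂ)) / (4 * (d : ℂ) ^ 2)

/-- `N` is the integer `N_k = d² |k + τ₀|²`. -/
def IsNk (d a b : ℕ) (k N : ℤ) : Prop :=
  (N : ℝ) = (d : ℝ) ^ 2 * ‖(k : ℂ) + tauZero d a b‖ ^ 2

/-- The Jacobi symbol `(p / (4k - 1))`, with the convention `(p / n) = (p / (-n))` for negative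
odd `n`. -/
def signSymbol (k : ℤ) (p : ℕ) : ℤ := jacobiSym (p : ℤ) (4 * k - 1).natAbs

/-
Split the theta series at `τ / 2` into its even and odd parts `E_τ` and `O_τ`. The addition formula
`θ(x + y) θ(x - y) = E(x) E(y) + O(x) O(y)` and the distribution relation for sums over `s / d` turn
criticality into `d (E, O)_{d²τ}(0) = λ (E, O)_τ(0)`. Proportional theta constants force the theta
functions themselves to agree up to a dilation and a Gaussian factor, because the duplication
formula determines them from their 2-jet at `0`; comparing zeros, `d² τ` and `τ` are related by a
matrix in `SL₂(ℤ)` whose off-diagonal entries are divisible by `4`. The transformation law of the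
theta constants, proved by Euclidean descent on the bottom row `(c, δ)`, then gives
`λ = J(c | δ) d √(c τ + δ)`. Here `λ²` is a root of `X² - T X + d²` for an integer `T`, and the
congruence `T ≡ d² + 1 (mod 16)` forced by the matrix is the admissibility condition on `(a, b)`.
-/

open Filter Topology
open scoped Real NumberTheorySymbols

section HasSum

variable {M : Type*} [AddCommMonoid M] [TopologicalSpace M] [ContinuousAdd M] {a b : M}

theorem hasSum_add_of_isCompl_range {α β γ : Type*} {f : α → M} {i : β → α} {j : γ → α}
    (hi : i.Injective) (hj : j.Injective) (hij : IsCompl (Set.range i) (Set.range j))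
    (ha : HasSum (f ∘ i) a) (hb : HasSum (f ∘ j) b) : HasSum f (a + b) :=
  (hi.hasSum_range_iff.mpr ha).add_isCompl hij (hj.hasSum_range_iff.mpr hb)

theorem hasSum_int_even_add_odd {f : ℤ → M} (ha : HasSum (fun m : ℤ => f (2 * m)) a)
    (hb : HasSum (fun m : ℤ => f (2 * m + 1)) b) : HasSum f (a + b) := by
  refine hasSum_add_of_isCompl_range (i := (2 * ·)) (j := (2 * · + 1))
    (fun x y h => by simpa using h) (fun x y h => by simpa using h) ?_ ha hb
  simpa only [range_two_mul, range_two_mul_add_one] using Int.isCompl_even_odd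

theorem hasSum_int_prod_add_sub {f : ℤ × ℤ → M}
    (ha : HasSum (fun x : ℤ × ℤ => f (x.1 + x.2, x.1 - x.2)) a)
    (hb : HasSum (fun x : ℤ × ℤ => f (x.1 + x.2 + 1, x.1 - x.2)) b) : HasSum f (a + b) := by
  refine hasSum_add_of_isCompl_range (i := fun x : ℤ × ℤ => (x.1 + x.2, x.1 - x.2))
    (j := fun x : ℤ × ℤ => (x.1 + x.2 + 1, x.1 - x.2)) ?_ ?_
    ⟨Set.disjoint_left.mpr ?_, codisjoint_iff_le_sup.mpr ?_⟩ ha hb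
  · rintro ⟨p, q⟩ ⟨r, s⟩ h
    simp only [Prod.mk.injEq] at h ⊢
    omega
  · rintro ⟨p, q⟩ ⟨r, s⟩ h
    simp only [Prod.mk.injEq] at h ⊢
    omega
  · rintro _ ⟨x, rfl⟩ ⟨y, hy⟩
    simp only [Prod.mk.injEq] at hy
    omega
  · rintro ⟨m, n⟩ -
    rcases Int.even_or_odd' (m + n) with ⟨k, h | h⟩
    · exact Or.inl ⟨(k, m - k), by simp only [Prod.mk.injEq]; omega⟩
    · exact Or.inr ⟨(k, m - k - 1), by simp only [Prod.mk.injEq]; omega⟩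

end HasSum

theorem geom_sum_zpow_of_isPrimitiveRoot {K : Type*} [Field K] {ζ : K} {d : ℕ}
    (hζ : IsPrimitiveRoot ζ d) (n : ℤ) :
    ∑ s ∈ Finset.range d, (ζ ^ n) ^ s = if (d : ℤ) ∣ n then (d : K) else 0 := by
  split_ifs with h
  · simp [(hζ.zpow_eq_one_iff_dvd n).mpr h]
  · rw [geom_sum_eq (mt (hζ.zpow_eq_one_iff_dvd n).mp h), ← zpow_natCast, zpow_comm,
      zpow_natCast, hζ.pow_eq_one, one_zpow, sub_self, zero_div]

section Theta

variable {τ : ℂ}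

theorem two_mul_im_pos (hτ : 0 < τ.im) : 0 < (2 * τ).im := by
  simpa using hτ

theorem half_im_pos (hτ : 0 < τ.im) : 0 < (τ / 2).im := by
  simpa using hτ

theorem natCast_sq_mul_im (d : ℕ) (τ : ℂ) : ((d : ℂ) ^ 2 * τ).im = (d : ℝ) ^ 2 * τ.im := by
  rw [← Complex.im_ofReal_mul]
  push_cast
  rfl

theorem natCast_sq_mul_im_pos (hτ : 0 < τ.im) (d : ℕ) [NeZero d] :
    0 < ((d : ℂ) ^ 2 * τ).im := by
  rw [natCast_sq_mul_im]
  have : (d : ℝ) ≠ 0 := NeZero.ne _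
  positivity

theorem jacobiTheta₂_add_int (z τ : ℂ) (n : ℤ) : jacobiTheta₂ (z + n) τ = jacobiTheta₂ z τ := by
  have h : Function.Periodic (jacobiTheta₂ · τ) 1 := fun u => jacobiTheta₂_add_left u τ
  simpa using h.int_mul n z

/-- The even part of the theta series at `τ / 2`: the sum of `exp (2 π i (τ m² + 2 m z))` over
`m ∈ ℤ`. -/
noncomputable def thetaEven (τ z : ℂ) : ℂ := jacobiTheta₂ (2 * z) (2 * τ)

/-- The odd part of the theta series at `τ / 2`: the sum of `exp (2 π i (τ m² + 2 m z))` over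
`m ∈ ℤ + 1 / 2`. -/
noncomputable def thetaOdd (τ z : ℂ) : ℂ :=
  cexp (π * I * τ / 2 + 2 * π * I * z) * jacobiTheta₂ (2 * z + τ) (2 * τ)

theorem hasSum_thetaEven (hτ : 0 < τ.im) (z : ℂ) :
    HasSum (fun m : ℤ => jacobiTheta₂_term (2 * m) z (τ / 2)) (thetaEven τ z) := by
  refine (hasSum_jacobiTheta₂_term (2 * z) (two_mul_im_pos hτ)).congr_fun fun m => ?_
  simp only [jacobiTheta₂_term]
  push_cast
  ring_nf

theorem hasSum_thetaOdd (hτ : 0 < τ.im) (z : ℂ) :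
    HasSum (fun m : ℤ => jacobiTheta₂_term (2 * m + 1) z (τ / 2)) (thetaOdd τ z) := by
  refine ((hasSum_jacobiTheta₂_term (2 * z + τ) (two_mul_im_pos hτ)).mul_left
    (cexp (π * I * τ / 2 + 2 * π * I * z))).congr_fun fun m => ?_
  simp only [jacobiTheta₂_term, ← Complex.exp_add]
  push_cast
  ring_nf

theorem jacobiTheta₂_half_eq (hτ : 0 < τ.im) (z : ℂ) :
    jacobiTheta₂ z (τ / 2) = thetaEven τ z + thetaOdd τ z :=
  (hasSum_jacobiTheta₂_term z (half_im_pos hτ)).unique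
    (hasSum_int_even_add_odd (hasSum_thetaEven hτ z) (hasSum_thetaOdd hτ z))

theorem thetaEven_neg (τ z : ℂ) : thetaEven τ (-z) = thetaEven τ z := by
  rw [thetaEven, thetaEven, mul_neg, jacobiTheta₂_neg_left]

theorem thetaOdd_neg (τ z : ℂ) : thetaOdd τ (-z) = thetaOdd τ z := by
  rw [thetaOdd, thetaOdd, ← jacobiTheta₂_neg_left,
    show -(2 * -z + τ) = (2 * z - τ) by ring,
    show (2 * z + τ) = (2 * z - τ) + 2 * τ by ring, jacobiTheta₂_add_left', ← mul_assoc,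
    ← Complex.exp_add]
  ring_nf

theorem thetaEven_add_half (τ z : ℂ) : thetaEven τ (z + 1 / 2) = thetaEven τ z := by
  rw [thetaEven, thetaEven, ← jacobiTheta₂_add_left (2 * z)]
  ring_nf

theorem thetaOdd_add_half (τ z : ℂ) : thetaOdd τ (z + 1 / 2) = -thetaOdd τ z := by
  rw [thetaOdd, thetaOdd, show 2 * (z + 1 / 2) + τ = (2 * z + τ) + 1 by ring,
    jacobiTheta₂_add_left, show (π * I * τ / 2 + 2 * π * I * (z + 1 / 2) : ℂ) =
      π * I * τ / 2 + 2 * π * I * z + π * I by ring, Complex.exp_add _ (π * I), exp_pi_mul_I]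
  ring

theorem thetaEven_add_half_tau (τ z : ℂ) :
    thetaEven τ (z + τ / 2) = cexp (-(π * I * τ / 2 + 2 * π * I * z)) * thetaOdd τ z := by
  rw [thetaOdd, Complex.exp_neg, inv_mul_cancel_left₀ (Complex.exp_ne_zero _), thetaEven]
  ring_nf

theorem thetaOdd_add_half_tau (τ z : ℂ) :
    thetaOdd τ (z + τ / 2) = cexp (-(π * I * τ / 2 + 2 * π * I * z)) * thetaEven τ z := by
  rw [thetaEven, thetaOdd, show 2 * (z + τ / 2) + τ = 2 * z + 2 * τ by ring,
    jacobiTheta₂_add_left', ← mul_assoc, ← Complex.exp_add]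
  ring_nf

theorem jacobiTheta₂_half_add_half_eq (hτ : 0 < τ.im) (z : ℂ) :
    jacobiTheta₂ (z + 1 / 2) (τ / 2) = thetaEven τ z - thetaOdd τ z := by
  rw [jacobiTheta₂_half_eq hτ, thetaEven_add_half, thetaOdd_add_half, sub_eq_add_neg]

theorem jacobiTheta₂_term_add_mul_term_sub (p q : ℤ) (z u τ : ℂ) :
    jacobiTheta₂_term (p + q) z (τ / 2) * jacobiTheta₂_term (p - q) u (τ / 2) =
      jacobiTheta₂_term p (z + u) τ * jacobiTheta₂_term q (z - u) τ := by
  simp only [jacobiTheta₂_term, ← Complex.exp_add]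
  push_cast
  ring_nf

theorem jacobiTheta₂_add_mul_sub (hτ : 0 < τ.im) (z u : ℂ) :
    jacobiTheta₂ (z + u) τ * jacobiTheta₂ (z - u) τ =
      thetaEven τ z * thetaEven τ u + thetaOdd τ z * thetaOdd τ u := by
  have hprod {f g : ℤ → ℂ} {a b : ℂ} (hf : HasSum f a) (hg : HasSum g b) :
      HasSum (fun x : ℤ × ℤ => f x.1 * g x.2) (a * b) :=
    hf.mul hg (summable_mul_of_summable_norm hf.summable.norm hg.summable.norm)
  have hterm {m n p q : ℤ} (hm : m = p + q) (hn : n = p - q) :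
      jacobiTheta₂_term p (z + u) τ * jacobiTheta₂_term q (z - u) τ =
        jacobiTheta₂_term m z (τ / 2) * jacobiTheta₂_term n u (τ / 2) := by
    rw [hm, hn, jacobiTheta₂_term_add_mul_term_sub]
  refine (hprod (hasSum_jacobiTheta₂_term (z + u) hτ)
    (hasSum_jacobiTheta₂_term (z - u) hτ)).unique (hasSum_int_prod_add_sub ?_ ?_)
  · exact (hprod (hasSum_thetaEven hτ z) (hasSum_thetaEven hτ u)).congr_fun
      fun x => hterm (by ring) (by ring)
  · exact (hprod (hasSum_thetaOdd hτ z) (hasSum_thetaOdd hτ u)).congr_fun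
      fun x => hterm (by ring) (by ring)

theorem jacobiTheta₂_add_mul_sub_halfPeriod (hτ : 0 < τ.im) (x y : ℂ) :
    jacobiTheta₂ (x + y + (1 + τ) / 2) τ * jacobiTheta₂ (x - y + (1 + τ) / 2) τ =
      cexp (-(π * I * τ / 2 + 2 * π * I * x)) *
        (thetaOdd τ x * thetaEven τ y - thetaEven τ x * thetaOdd τ y) := by
  rw [show x + y + (1 + τ) / 2 = (x + τ / 2 + 1 / 2) + y by ring,
    show x - y + (1 + τ) / 2 = (x + τ / 2 + 1 / 2) - y by ring, jacobiTheta₂_add_mul_sub hτ,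
    thetaEven_add_half, thetaOdd_add_half, thetaEven_add_half_tau, thetaOdd_add_half_tau]
  ring

theorem sum_jacobiTheta₂_term_add_div (d : ℕ) [NeZero d] (n : ℤ) (z τ : ℂ) :
    ∑ s ∈ Finset.range d, jacobiTheta₂_term n (z + s / d) τ =
      if (d : ℤ) ∣ n then d * jacobiTheta₂_term n z τ else 0 := by
  have hterm (s : ℕ) : jacobiTheta₂_term n (z + s / d) τ =
      jacobiTheta₂_term n z τ * (cexp (2 * π * I / d) ^ n) ^ s := by
    rw [← Complex.exp_int_mul, ← Complex.exp_nat_mul]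
    simp only [jacobiTheta₂_term, ← Complex.exp_add]
    ring_nf
  simp_rw [hterm, ← Finset.mul_sum,
    geom_sum_zpow_of_isPrimitiveRoot (Complex.isPrimitiveRoot_exp d (NeZero.ne d)), mul_ite,
    mul_zero, mul_comm]

theorem sum_jacobiTheta₂_add_div (hτ : 0 < τ.im) (d : ℕ) [NeZero d] (z : ℂ) :
    ∑ s ∈ Finset.range d, jacobiTheta₂ (z + s / d) τ =
      d * jacobiTheta₂ (d * z) ((d : ℂ) ^ 2 * τ) := by
  have hsum : HasSum (fun n : ℤ => ∑ s ∈ Finset.range d, jacobiTheta₂_term n (z + s / d) τ)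
      (∑ s ∈ Finset.range d, jacobiTheta₂ (z + s / d) τ) :=
    hasSum_sum fun s _ => hasSum_jacobiTheta₂_term _ hτ
  have hinj : Function.Injective fun j : ℤ => (d : ℤ) * j :=
    mul_right_injective₀ (NeZero.ne _)
  simp only [sum_jacobiTheta₂_term_add_div] at hsum
  refine hsum.unique ((hinj.hasSum_iff fun n hn => if_neg ?_).mp ?_)
  · rintro ⟨j, rfl⟩
    exact hn ⟨j, rfl⟩
  · refine ((hasSum_jacobiTheta₂_term (d * z) (natCast_sq_mul_im_pos hτ d)).mul_left
      (d : ℂ)).congr_fun fun j => ?_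
    simp only [Function.comp_apply, dvd_mul_right, if_true, jacobiTheta₂_term]
    push_cast
    ring_nf

theorem differentiable_jacobiTheta₂ (hτ : 0 < τ.im) : Differentiable ℂ (jacobiTheta₂ · τ) :=
  fun z => differentiableAt_jacobiTheta₂_fst z hτ

theorem differentiable_thetaEven (hτ : 0 < τ.im) : Differentiable ℂ (thetaEven τ) :=
  (differentiable_jacobiTheta₂ (two_mul_im_pos hτ)).comp (differentiable_id.const_mul 2)

theorem differentiable_thetaOdd (hτ : 0 < τ.im) : Differentiable ℂ (thetaOdd τ) := by
  have h := (differentiable_jacobiTheta₂ (two_mul_im_pos hτ)).comp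
    ((differentiable_id.const_mul (2 : ℂ)).add_const τ)
  unfold thetaOdd
  exact Differentiable.mul (by fun_prop) h

theorem tendsto_jacobiTheta_comap_im_atTop : Tendsto jacobiTheta (comap im atTop) (𝓝 1) := by
  have hexp : Tendsto (fun τ : ℂ => Real.exp (-π * τ.im)) (comap im atTop) (𝓝 0) :=
    Real.tendsto_exp_atBot.comp (tendsto_comap.const_mul_atTop_of_neg (neg_lt_zero.mpr Real.pi_pos))
  simpa using (isBigO_at_im_infty_jacobiTheta_sub_one.trans_tendsto hexp).add_const 1

theorem exists_jacobiTheta₂_ne_zero (hτ : 0 < τ.im) : ∃ z, jacobiTheta₂ z τ ≠ 0 := by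
  -- By the distribution relation `θ(0, n² τ)` would vanish for all `n`, but it tends to `1`.
  by_contra! h
  have hzero (n : ℕ) : jacobiTheta (((n + 1 : ℕ) : ℂ) ^ 2 * τ) = 0 := by
    have hsum := sum_jacobiTheta₂_add_div hτ (n + 1) 0
    simp only [h, Finset.sum_const_zero, mul_zero] at hsum
    rw [jacobiTheta_eq_jacobiTheta₂]
    exact (mul_eq_zero.mp hsum.symm).resolve_left (NeZero.ne _)
  have him : Tendsto (fun n : ℕ => ((n + 1 : ℕ) : ℂ) ^ 2 * τ) atTop (comap im atTop) := by
    refine tendsto_comap_iff.mpr ?_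
    simp only [Function.comp_def, natCast_sq_mul_im]
    exact ((tendsto_pow_atTop two_ne_zero).comp (tendsto_natCast_atTop_atTop.comp
      (tendsto_add_atTop_nat 1))).atTop_mul_const hτ
  have hone := tendsto_jacobiTheta_comap_im_atTop.comp him
  simp only [Function.comp_def, hzero] at hone
  exact zero_ne_one (tendsto_nhds_unique tendsto_const_nhds hone)

end Theta

theorem eq_of_eventuallyEq_of_differentiable {E : Type*} [NormedAddCommGroup E] [NormedSpace ℂ E]
    [CompleteSpace E] {f g : ℂ → E} (hf : Differentiable ℂ f) (hg : Differentiable ℂ g) {z₀ : ℂ}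
    (h : f =ᶠ[𝓝 z₀] g) : f = g :=
  AnalyticOnNhd.eq_of_eventuallyEq (fun z _ => hf.analyticAt z) (fun z _ => hg.analyticAt z) h

theorem exists_ne_zero_and_ne_zero {f g : ℂ → ℂ} (hf : Differentiable ℂ f)
    (hg : Differentiable ℂ g) (hf0 : ∃ z, f z ≠ 0) (hg0 : ∃ z, g z ≠ 0) :
    ∃ z, f z ≠ 0 ∧ g z ≠ 0 := by
  obtain ⟨z, hz⟩ := hf0
  obtain ⟨w, hw⟩ := hg0
  by_contra! h
  refine hw (congrFun (eq_of_eventuallyEq_of_differentiable hg (differentiable_const 0)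
    (z₀ := z) ?_) w)
  filter_upwards [hf.continuous.continuousAt.eventually_ne hz] with x hx using h x hx

theorem exists_eq_const_mul_exp_mul {f g : ℂ → ℂ} (hf : Differentiable ℂ f)
    (hg : Differentiable ℂ g) (η : ℂ)
    (h : ∀ s, g s * deriv f s - f s * deriv g s = η * f s * g s) (hg0 : ∃ s, g s ≠ 0) :
    ∃ C : ℂ, ∀ s, f s = C * cexp (η * s) * g s := by
  obtain ⟨s₀, hs₀⟩ := hg0
  obtain ⟨r, hr, hball⟩ := Metric.eventually_nhds_iff_ball.mp
    (hg.continuous.continuousAt.eventually_ne hs₀)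
  set q : ℂ → ℂ := fun s => f s / g s * cexp (-(η * s)) with hq
  have hderiv : ∀ s ∈ Metric.ball s₀ r, HasDerivAt q 0 s := by
    intro s hs
    have hgs := hball s hs
    have h1 := ((hf s).hasDerivAt.div (hg s).hasDerivAt hgs).mul
      (((hasDerivAt_id s).const_mul η).neg.cexp)
    refine h1.congr_deriv ?_
    simp only [id, Pi.div_apply]
    rw [show deriv f s = (η * f s * g s + f s * deriv g s) / g s by
      rw [eq_div_iff hgs]; linear_combination h s]
    field_simp
    ring
  have hconst : ∀ s ∈ Metric.ball s₀ r, q s = q s₀ := fun s hs =>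
    Metric.isOpen_ball.is_const_of_deriv_eq_zero (convex_ball s₀ r).isPreconnected
      (fun x hx => (hderiv x hx).differentiableAt.differentiableWithinAt)
      (fun x hx => (hderiv x hx).deriv) hs (Metric.mem_ball_self hr)
  refine ⟨q s₀, fun s => congrFun (eq_of_eventuallyEq_of_differentiable hf
    (g := fun s => q s₀ * cexp (η * s) * g s) (by fun_prop) (z₀ := s₀) ?_) s⟩
  filter_upwards [Metric.ball_mem_nhds s₀ hr] with x hx
  rw [← hconst x hx, hq, mul_assoc (f x / g x), ← Complex.exp_add, neg_add_cancel,
    Complex.exp_zero, mul_one, div_mul_cancel₀ _ (hball x hx)]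

theorem hasDerivAt_comp_add_mul_comp_sub {f : ℂ → ℂ} (hf : Differentiable ℂ f) (s t : ℂ) :
    HasDerivAt (fun e => f (s + e) * f (t - e)) (deriv f s * f t - f s * deriv f t) 0 := by
  have h1 : HasDerivAt (fun e => f (s + e)) (deriv f s) 0 :=
    HasDerivAt.comp_const_add s 0 (by simpa using (hf s).hasDerivAt)
  have h2 : HasDerivAt (fun e => f (t - e)) (-deriv f t) 0 :=
    HasDerivAt.comp_const_sub t 0 (by simpa using (hf t).hasDerivAt)
  refine (h1.mul h2).congr_deriv ?_
  simp only [add_zero, sub_zero]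
  ring

theorem exists_eq_const_mul_exp_mul_of_mul_eq {f g : ℂ → ℂ} (hf : Differentiable ℂ f)
    (hg : Differentiable ℂ g)
    (h : ∀ s t e, f s * f t * (g (s + e) * g (t - e)) = g s * g t * (f (s + e) * f (t - e)))
    {s₀ : ℂ} (hfs : f s₀ ≠ 0) (hgs : g s₀ ≠ 0) :
    ∃ η C : ℂ, ∀ s, f s = C * cexp (η * s) * g s := by
  have hderiv : ∀ s t, f s * f t * (deriv g s * g t - g s * deriv g t) =
      g s * g t * (deriv f s * f t - f s * deriv f t) := fun s t =>
    ((hasDerivAt_comp_add_mul_comp_sub hg s t).const_mul (f s * f t)).unique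
      (((hasDerivAt_comp_add_mul_comp_sub hf s t).const_mul (g s * g t)).congr_of_eventuallyEq
        (.of_forall (h s t)))
  refine ⟨deriv f s₀ / f s₀ - deriv g s₀ / g s₀,
    exists_eq_const_mul_exp_mul hf hg _ (fun s => ?_) ⟨s₀, hgs⟩⟩
  field_simp
  linear_combination -hderiv s s₀

section Zeros

variable {τ : ℂ}

theorem jacobiTheta₂_halfPeriod (hτ : 0 < τ.im) : jacobiTheta₂ ((1 + τ) / 2) τ = 0 := by
  simpa [mul_comm] using jacobiTheta₂_add_mul_sub_halfPeriod hτ 0 0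

theorem jacobiTheta₂_add_lattice_eq_zero_iff (τ z : ℂ) (m n : ℤ) :
    jacobiTheta₂ (z + m + n * τ) τ = 0 ↔ jacobiTheta₂ z τ = 0 := by
  have h : Function.Periodic (fun z => jacobiTheta₂ z τ = 0) τ := fun z => by
    simp [jacobiTheta₂_add_left', Complex.exp_ne_zero]
  rw [← jacobiTheta₂_add_int z τ m]
  exact iff_of_eq (h.int_mul n (z + m))

theorem thetaOdd_add_mul_thetaEven_of_eq_zero (hτ : 0 < τ.im) {w : ℂ}
    (hw : jacobiTheta₂ (w + (1 + τ) / 2) τ = 0) (y : ℂ) :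
    thetaOdd τ (y + w) * thetaEven τ y = thetaEven τ (y + w) * thetaOdd τ y := by
  have h := jacobiTheta₂_add_mul_sub_halfPeriod hτ (y + w) y
  rw [add_sub_cancel_left, hw, mul_zero, eq_comm, mul_eq_zero,
    or_iff_right (Complex.exp_ne_zero _)] at h
  exact sub_eq_zero.mp h

theorem exists_jacobiTheta₂_add_eq (hτ : 0 < τ.im) {w : ℂ}
    (hw : jacobiTheta₂ (w + (1 + τ) / 2) τ = 0) :
    ∃ η C : ℂ, ∀ s, jacobiTheta₂ (s + w) τ = C * cexp (η * s) * jacobiTheta₂ s τ := by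
  have hθ := differentiable_jacobiTheta₂ hτ
  have hφ : Differentiable ℂ fun s => jacobiTheta₂ (s + w) τ :=
    hθ.comp (differentiable_id.add_const w)
  obtain ⟨z, hz⟩ := exists_jacobiTheta₂_ne_zero hτ
  obtain ⟨s₀, hφs, hθs⟩ := exists_ne_zero_and_ne_zero hφ hθ ⟨z - w, by simpa using hz⟩ ⟨z, hz⟩
  refine exists_eq_const_mul_exp_mul_of_mul_eq hφ hθ (fun s t e => ?_) hφs hθs
  obtain ⟨m, u, rfl, rfl⟩ : ∃ m u, s = m + u ∧ t = m - u :=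
    ⟨(s + t) / 2, (s - t) / 2, by ring, by ring⟩
  have hm := thetaOdd_add_mul_thetaEven_of_eq_zero hτ hw m
  have h1 := jacobiTheta₂_add_mul_sub hτ (m + w) u
  have h2 := jacobiTheta₂_add_mul_sub hτ m (u + e)
  have h3 := jacobiTheta₂_add_mul_sub hτ m u
  have h4 := jacobiTheta₂_add_mul_sub hτ (m + w) (u + e)
  rw [show m + u + w = m + w + u by ring, show m - u + w = m + w - u by ring,
    show m + u + e = m + (u + e) by ring, show m - u - e = m - (u + e) by ring,
    show m + (u + e) + w = m + w + (u + e) by ring,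
    show m - (u + e) + w = m + w - (u + e) by ring, h1, h2, h3, h4]
  linear_combination (thetaOdd τ u * thetaEven τ (u + e) - thetaEven τ u * thetaOdd τ (u + e)) * hm

theorem mem_lattice_of_jacobiTheta₂_add_eq (hτ : 0 < τ.im) {w η C : ℂ}
    (h : ∀ s, jacobiTheta₂ (s + w) τ = C * cexp (η * s) * jacobiTheta₂ s τ) :
    ∃ m n : ℤ, w = m + n * τ := by
  obtain ⟨z, hz⟩ := exists_jacobiTheta₂_ne_zero hτ
  obtain ⟨s, hs⟩ : ∃ s, jacobiTheta₂ (s + w) τ ≠ 0 := ⟨z - w, by simpa using hz⟩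
  have hone : cexp η = 1 := by
    have h1 := h (s + 1)
    rw [add_right_comm, jacobiTheta₂_add_left, jacobiTheta₂_add_left, mul_add, Complex.exp_add,
      mul_one] at h1
    refine mul_left_cancel₀ hs ?_
    linear_combination cexp η * h s - h1
  have htau : cexp (-(2 * π * I * w)) = cexp (η * τ) := by
    have h1 := h (s + τ)
    rw [add_right_comm, jacobiTheta₂_add_left', jacobiTheta₂_add_left', mul_add η,
      Complex.exp_add (η * s),
      show (-π * I * (τ + 2 * (s + w)) : ℂ) = -π * I * (τ + 2 * s) + -(2 * π * I * w) by ring,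
      Complex.exp_add] at h1
    refine mul_left_cancel₀ (mul_ne_zero (Complex.exp_ne_zero (-π * I * (τ + 2 * s))) hs) ?_
    linear_combination h1 - cexp (η * τ) * cexp (-π * I * (τ + 2 * s)) * h s
  obtain ⟨n, hn⟩ := Complex.exp_eq_one_iff.mp hone
  obtain ⟨m, hm⟩ := Complex.exp_eq_exp_iff_exists_int.mp htau
  refine ⟨-m, -n, mul_left_cancel₀ Complex.two_pi_I_ne_zero ?_⟩
  push_cast
  linear_combination -hm - τ * hn

theorem jacobiTheta₂_eq_zero_iff (hτ : 0 < τ.im) (z : ℂ) :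
    jacobiTheta₂ z τ = 0 ↔ ∃ m n : ℤ, z = (1 + τ) / 2 + m + n * τ := by
  constructor
  · intro h
    obtain ⟨η, C, hC⟩ := exists_jacobiTheta₂_add_eq hτ (w := z - (1 + τ) / 2)
      (by rwa [sub_add_cancel])
    obtain ⟨m, n, hmn⟩ := mem_lattice_of_jacobiTheta₂_add_eq hτ hC
    exact ⟨m, n, by linear_combination hmn⟩
  · rintro ⟨m, n, rfl⟩
    rw [jacobiTheta₂_add_lattice_eq_zero_iff]
    exact jacobiTheta₂_halfPeriod hτ

theorem thetaOdd_eq_zero_iff (hτ : 0 < τ.im) (z : ℂ) :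
    thetaOdd τ z = 0 ↔ ∃ m n : ℤ, z = 1 / 4 + m / 2 + n * τ := by
  rw [thetaOdd, mul_eq_zero, or_iff_right (Complex.exp_ne_zero _),
    jacobiTheta₂_eq_zero_iff (two_mul_im_pos hτ)]
  refine exists_congr fun m => exists_congr fun n => ⟨fun h => ?_, fun h => ?_⟩
  · linear_combination h / 2
  · linear_combination 2 * h

theorem thetaEven_sub_thetaOdd_eq_zero_iff (hτ : 0 < τ.im) (z : ℂ) :
    thetaEven τ z - thetaOdd τ z = 0 ↔ ∃ m n : ℤ, z = τ / 4 + m + n * (τ / 2) := by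
  rw [← jacobiTheta₂_half_add_half_eq hτ, jacobiTheta₂_eq_zero_iff (half_im_pos hτ)]
  refine exists_congr fun m => exists_congr fun n => ⟨fun h => ?_, fun h => ?_⟩
  · linear_combination h
  · linear_combination h

theorem jacobiTheta₂_ofReal_ne_zero (hτ : 0 < τ.im) (x : ℝ) : jacobiTheta₂ x τ ≠ 0 := by
  rw [Ne, jacobiTheta₂_eq_zero_iff hτ]
  rintro ⟨m, n, h⟩
  have him : 0 = (1 + 2 * n) * (τ.im / 2) := by
    have h0 := congrArg Complex.im h
    simp only [ofReal_im, add_im, div_ofNat_im, one_im, zero_add, intCast_im, add_zero, mul_im,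
      intCast_re, zero_mul] at h0
    linear_combination h0
  rcases mul_eq_zero.mp him.symm with hn | h0
  · have : (1 + 2 * n : ℤ) = 0 := by exact_mod_cast hn
    omega
  · linarith

theorem thetaEven_zero_ne_zero (hτ : 0 < τ.im) : thetaEven τ 0 ≠ 0 := by
  simpa [thetaEven] using jacobiTheta₂_ofReal_ne_zero (two_mul_im_pos hτ) 0

theorem thetaOdd_zero_ne_zero (hτ : 0 < τ.im) : thetaOdd τ 0 ≠ 0 := by
  rw [Ne, thetaOdd_eq_zero_iff hτ]
  rintro ⟨m, n, h⟩
  have hn : (n : ℝ) = 0 := by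
    have him := congrArg Complex.im h
    simpa [hτ.ne'] using him
  have hm : (1 / 4 + m / 2 : ℝ) = 0 := by
    have hre := congrArg Complex.re h
    simpa [hn] using hre.symm
  have : (1 + 2 * m : ℤ) = 0 := by
    have : (1 + 2 * m : ℝ) = 0 := by linarith
    exact_mod_cast this
  omega

theorem thetaEven_pow_four_sub_thetaOdd_pow_four_ne_zero (hτ : 0 < τ.im) :
    thetaEven τ 0 ^ 4 - thetaOdd τ 0 ^ 4 ≠ 0 := by
  have hadd := jacobiTheta₂_add_mul_sub hτ 0 0
  have hsub := jacobiTheta₂_add_mul_sub hτ (0 + 1 / 2) 0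
  rw [thetaEven_add_half, thetaOdd_add_half] at hsub
  have h0 := jacobiTheta₂_ofReal_ne_zero hτ 0
  have h1 := jacobiTheta₂_ofReal_ne_zero hτ (1 / 2)
  simp only [add_zero, sub_zero, zero_add] at hadd hsub
  push_cast at h0 h1
  have hfactor : thetaEven τ 0 ^ 4 - thetaOdd τ 0 ^ 4 =
      jacobiTheta₂ 0 τ * jacobiTheta₂ 0 τ * (jacobiTheta₂ (1 / 2) τ * jacobiTheta₂ (1 / 2) τ) := by
    rw [hadd, hsub]
    ring
  rw [hfactor]
  exact mul_ne_zero (mul_ne_zero h0 h0) (mul_ne_zero h1 h1)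

theorem thetaOdd_mul_deriv_thetaEven_sub (hτ : 0 < τ.im) (y : ℂ) :
    deriv (thetaOdd τ) y * thetaEven τ y - deriv (thetaEven τ) y * thetaOdd τ y =
      cexp (π * I * τ / 2 + 2 * π * I * y) * deriv (fun x => jacobiTheta₂ (x + (1 + τ) / 2) τ) 0 *
        jacobiTheta₂ (y + y + (1 + τ) / 2) τ := by
  set g : ℂ → ℂ := fun x => jacobiTheta₂ (x + (1 + τ) / 2) τ with hg
  have hgd : Differentiable ℂ g :=
    (differentiable_jacobiTheta₂ hτ).comp (differentiable_id.add_const _)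
  have hg0 : g 0 = 0 := by simpa [hg] using jacobiTheta₂_halfPeriod hτ
  have hprod : HasDerivAt (fun x => g (x + y) * g (x - y)) (g (y + y) * deriv g 0) y := by
    have h1 := HasDerivAt.comp_add_const y y (hgd (y + y)).hasDerivAt
    have h2 := HasDerivAt.comp_sub_const y y (hgd (y - y)).hasDerivAt
    refine (h1.mul h2).congr_deriv ?_
    simp [hg0]
  have hquot : HasDerivAt (fun x => cexp (π * I * τ / 2 + 2 * π * I * x) * (g (x + y) * g (x - y)))
      (deriv (thetaOdd τ) y * thetaEven τ y - deriv (thetaEven τ) y * thetaOdd τ y) y := by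
    refine ((((differentiable_thetaOdd hτ y).hasDerivAt.mul_const (thetaEven τ y)).sub
      ((differentiable_thetaEven hτ y).hasDerivAt.mul_const (thetaOdd τ y))).congr_of_eventuallyEq
        (.of_forall fun x => ?_))
    simp only [hg, Pi.sub_apply]
    rw [jacobiTheta₂_add_mul_sub_halfPeriod hτ x y, Complex.exp_neg,
      mul_inv_cancel_left₀ (Complex.exp_ne_zero _)]
  have hexp : HasDerivAt (fun x => cexp (π * I * τ / 2 + 2 * π * I * x))
      (deriv (fun x => cexp (π * I * τ / 2 + 2 * π * I * x)) y) y :=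
    DifferentiableAt.hasDerivAt (by fun_prop)
  refine (hquot.unique (hexp.mul hprod)).trans ?_
  simp only [sub_self, hg0]
  ring

theorem deriv_jacobiTheta₂_halfPeriod_ne_zero (hτ : 0 < τ.im) :
    deriv (fun x => jacobiTheta₂ (x + (1 + τ) / 2) τ) 0 ≠ 0 := by
  -- Otherwise the even and the odd part are proportional, but they behave differently under
  -- `x ↦ x + 1 / 2`.
  intro h0
  have hwronskian : ∀ y, thetaOdd τ y * deriv (thetaEven τ) y -
      thetaEven τ y * deriv (thetaOdd τ) y = 0 * thetaEven τ y * thetaOdd τ y := by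
    intro y
    have h := thetaOdd_mul_deriv_thetaEven_sub hτ y
    rw [h0] at h
    linear_combination -h
  obtain ⟨C, hC⟩ := exists_eq_const_mul_exp_mul (differentiable_thetaEven hτ)
    (differentiable_thetaOdd hτ) 0 hwronskian ⟨0, thetaOdd_zero_ne_zero hτ⟩
  have h1 := hC 0
  have h2 := hC (0 + 1 / 2)
  rw [thetaEven_add_half, thetaOdd_add_half] at h2
  simp only [zero_mul, Complex.exp_zero, mul_one] at h1 h2
  exact thetaEven_zero_ne_zero hτ (by linear_combination (h1 + h2) / 2)

end Zeros

section Rigidity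

variable {𝕜 E : Type*} [NontriviallyNormedField 𝕜] [NormedAddCommGroup E] [NormedSpace 𝕜 E]

theorem eq_zero_of_pow_smul_isLittleO {h : 𝕜 → E} (hh : ContinuousAt h 0) {n : ℕ}
    (ho : (fun x => x ^ n • h x) =o[𝓝 0] fun x => x ^ n) : h 0 = 0 := by
  have hlim : Tendsto h (𝓝[≠] 0) (𝓝 0) := by
    refine (ho.tendsto_inv_smul_nhds_zero.mono_left nhdsWithin_le_nhds).congr' ?_
    filter_upwards [self_mem_nhdsWithin] with x hx
    exact inv_smul_smul₀ (pow_ne_zero n hx) (h x)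
  exact tendsto_nhds_unique (hh.tendsto.mono_left nhdsWithin_le_nhds) hlim

theorem eventuallyEq_of_comp_const_mul_eq {Φ : E → E} {p : E} {q : 𝕜} {m : ℕ} (hq : 1 < ‖q‖)
    (hΦ : HasStrictFDerivAt Φ (q ^ m • ContinuousLinearMap.id 𝕜 E) p) {f g : 𝕜 → E}
    (hf : AnalyticAt 𝕜 f 0) (hg : AnalyticAt 𝕜 g 0) (hf0 : f 0 = p) (hg0 : g 0 = p)
    (hfΦ : ∀ x, f (q * x) = Φ (f x)) (hgΦ : ∀ x, g (q * x) = Φ (g x))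
    (hfg : (fun x => f x - g x) =o[𝓝 0] fun x => x ^ m) : f =ᶠ[𝓝 0] g := by
  -- If `f - g` had leading term `c x ^ n`, comparing the terms of order `n` in the two
  -- functional equations would give `q ^ n c = q ^ m c`, hence `n = m`.
  by_contra hne
  obtain ⟨n, h, hh, hh0, hn⟩ := (hf.sub hg).exists_eventuallyEq_pow_smul_nonzero_iff.mpr
    fun h0 => hne (h0.mono fun x hx => sub_eq_zero.mp hx)
  simp only [sub_zero, Pi.sub_apply] at hn
  have hmul : Tendsto (fun x : 𝕜 => q * x) (𝓝 0) (𝓝 0) := by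
    simpa using (continuous_const_mul q).tendsto 0
  have hnm : n ≠ m := by
    rintro rfl
    exact hh0 (eq_zero_of_pow_smul_isLittleO hh.continuousAt (hfg.congr' hn .rfl))
  have hO : (fun x => f x - g x) =O[𝓝 0] fun x => x ^ n := by
    have := (Asymptotics.isBigO_refl (fun x : 𝕜 => x ^ n) (𝓝 0)).smul
      (hh.continuousAt.tendsto.isBigO_one 𝕜)
    simp only [smul_eq_mul, mul_one] at this
    exact this.congr' (hn.mono fun x hx => hx.symm) .rfl
  have hpair : Tendsto (fun x => (f x, g x)) (𝓝 0) (𝓝 (p, p)) := by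
    simpa only [hf0, hg0] using hf.continuousAt.tendsto.prodMk_nhds hg.continuousAt.tendsto
  have hstrict := (hΦ.isLittleO.comp_tendsto hpair).trans_isBigO hO
  have hlead : q ^ n • h (q * 0) - q ^ m • h 0 = 0 := by
    refine eq_zero_of_pow_smul_isLittleO (n := n) (h := fun x => q ^ n • h (q * x) - q ^ m • h x)
      ?_ (hstrict.congr' ?_ .rfl)
    · refine .sub (.const_smul (ContinuousAt.comp (f := fun x => q * x) ?_ ?_) _)
        (hh.continuousAt.const_smul _)
      · simpa using hh.continuousAt
      · fun_prop
    · filter_upwards [hn, hmul.eventually hn] with x hx hqx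
      change Φ (f x) - Φ (g x) - q ^ m • (f x - g x) = _
      rw [← hfΦ, ← hgΦ, hqx, hx, mul_pow, smul_sub, smul_smul, smul_smul, smul_smul, mul_comm,
        mul_comm (q ^ m)]
  rw [mul_zero, ← sub_smul, smul_eq_zero, or_iff_left hh0, sub_eq_zero] at hlead
  refine hnm (pow_right_injective₀ (zero_lt_one.trans hq) hq.ne' ?_)
  simpa only [norm_pow] using congrArg norm hlead

end Rigidity

theorem differentiable_dslope {f : ℂ → ℂ} (hf : Differentiable ℂ f) (c : ℂ) :
    Differentiable ℂ (dslope f c) :=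
  differentiableOn_univ.mp ((Complex.differentiableOn_dslope univ_mem).mpr hf.differentiableOn)

/-- `f x = f 0 + α x² + o(x²)` as `x → 0`, in Carathéodory form: `f x - f 0` is `x²` times a
function that is continuous at `0` with value `α`. -/
def HasQuadraticTerm (f : ℂ → ℂ) (α : ℂ) : Prop :=
  ∃ k : ℂ → ℂ, ContinuousAt k 0 ∧ k 0 = α ∧ ∀ x, f x = f 0 + x ^ 2 * k x

namespace HasQuadraticTerm

variable {f g : ℂ → ℂ} {α β : ℂ}

theorem of_even (hf : Differentiable ℂ f) (heven : ∀ x, f (-x) = f x) :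
    ∃ α, HasQuadraticTerm f α := by
  refine ⟨_, dslope (dslope f 0) 0,
    (differentiable_dslope (differentiable_dslope hf 0) 0).continuous.continuousAt, rfl,
    fun x => ?_⟩
  have hderiv : deriv f 0 = 0 := by
    have h := deriv_comp_neg f 0
    rw [funext heven, neg_zero] at h
    linear_combination h / 2
  have h1 := sub_smul_dslope f 0 x
  have h2 := sub_smul_dslope (dslope f 0) 0 x
  rw [dslope_same, hderiv] at h2
  simp only [sub_zero, smul_eq_mul] at h1 h2
  linear_combination -h1 - x * h2

theorem exp_mul_sq (ρ : ℂ) : HasQuadraticTerm (fun x => cexp (ρ * x ^ 2)) ρ := by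
  have hd := (differentiable_dslope Complex.differentiable_exp 0).continuous
  refine ⟨fun x => ρ * dslope cexp 0 (ρ * x ^ 2), by fun_prop, by simp, fun x => ?_⟩
  have h := sub_smul_dslope cexp 0 (ρ * x ^ 2)
  simp only [sub_zero, smul_eq_mul, Complex.exp_zero] at h
  simp only [ne_eq, OfNat.ofNat_ne_zero, not_false_eq_true, zero_pow, mul_zero, Complex.exp_zero]
  linear_combination -h

theorem const_mul (hf : HasQuadraticTerm f α) (κ : ℂ) :
    HasQuadraticTerm (fun x => κ * f x) (κ * α) := by
  obtain ⟨k, hk, rfl, h⟩ := hf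
  exact ⟨fun x => κ * k x, by fun_prop, rfl, fun x => by
    beta_reduce; rw [h x]; ring⟩

theorem mul (hf : HasQuadraticTerm f α) (hg : HasQuadraticTerm g β) :
    HasQuadraticTerm (fun x => f x * g x) (f 0 * β + α * g 0) := by
  obtain ⟨k, hk, rfl, hk'⟩ := hf
  obtain ⟨l, hl, rfl, hl'⟩ := hg
  exact ⟨fun x => f 0 * l x + k x * g 0 + x ^ 2 * k x * l x, by fun_prop, by simp,
    fun x => by beta_reduce; rw [hk' x, hl' x]; ring⟩

theorem comp_const_mul (hf : HasQuadraticTerm f α) (c : ℂ) :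
    HasQuadraticTerm (fun x => f (c * x)) (c ^ 2 * α) := by
  obtain ⟨k, hk, rfl, h⟩ := hf
  have hkc : ContinuousAt (fun x => k (c * x)) 0 :=
    ContinuousAt.comp (f := fun x => c * x) (by simpa using hk) (by fun_prop)
  exact ⟨fun x => c ^ 2 * k (c * x), hkc.const_mul _, by simp, fun x => by
    beta_reduce; rw [h (c * x), mul_zero]; ring⟩

theorem sub_isLittleO (hf : HasQuadraticTerm f α) (hg : HasQuadraticTerm g α) (h0 : f 0 = g 0) :
    (fun x => f x - g x) =o[𝓝 0] fun x => x ^ 2 := by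
  obtain ⟨k, hk, rfl, hk'⟩ := hf
  obtain ⟨l, hl, hlk, hl'⟩ := hg
  refine Asymptotics.isLittleO_iff_exists_eq_mul.mpr ⟨fun x => k x - l x, ?_,
    .of_forall fun x => ?_⟩
  · simpa [hlk] using hk.tendsto.sub hl.tendsto
  · simp only [Pi.mul_apply]
    rw [hk' x, hl' x, h0]
    ring

end HasQuadraticTerm

/-- The quartic map that expresses the values of `(thetaEven τ, thetaOdd τ)` at `2 x` through those
at `x`, where `(a, b)` are the values at `0`. -/
noncomputable def thetaDuplication (a b : ℂ) (w : ℂ × ℂ) : ℂ × ℂ :=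
  ((a ^ 2 * (w.1 ^ 4 + w.2 ^ 4) - 2 * b ^ 2 * w.1 ^ 2 * w.2 ^ 2) / ((a ^ 4 - b ^ 4) * a),
    (2 * a ^ 2 * w.1 ^ 2 * w.2 ^ 2 - b ^ 2 * (w.1 ^ 4 + w.2 ^ 4)) / ((a ^ 4 - b ^ 4) * b))

theorem thetaDuplication_mul {κ : ℂ} (hκ : κ ≠ 0) (a b e u v : ℂ) :
    thetaDuplication (κ * a) (κ * b) (κ * e * u, κ * e * v) =
      (κ * e ^ 4) • thetaDuplication a b (u, v) := by
  have hdiv {n n' m m' : ℂ} (hn : n = κ ^ 5 * (κ * e ^ 4 * n')) (hm : m = κ ^ 5 * m') :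
      n / m = κ * e ^ 4 * (n' / m') := by
    rw [hn, hm, mul_div_mul_left _ _ (pow_ne_zero 5 hκ), mul_div_assoc]
  exact Prod.ext (hdiv (by ring) (by ring)) (hdiv (by ring) (by ring))

theorem hasStrictFDerivAt_thetaDuplication {a b : ℂ} (ha : a ≠ 0) (hb : b ≠ 0)
    (hab : a ^ 4 - b ^ 4 ≠ 0) :
    HasStrictFDerivAt (thetaDuplication a b) ((2 : ℂ) ^ 2 • ContinuousLinearMap.id ℂ (ℂ × ℂ))
      (a, b) := by
  have h1 : HasStrictFDerivAt (fun w : ℂ × ℂ => w.1) (ContinuousLinearMap.fst ℂ ℂ ℂ) (a, b) :=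
    hasStrictFDerivAt_fst
  have h2 : HasStrictFDerivAt (fun w : ℂ × ℂ => w.2) (ContinuousLinearMap.snd ℂ ℂ ℂ) (a, b) :=
    hasStrictFDerivAt_snd
  have hquartic := (h1.pow 4).add (h2.pow 4)
  have hsquares (s : ℂ) := ((h1.pow 2).const_mul (2 * s ^ 2)).mul (h2.pow 2)
  have hfst := ((hquartic.const_mul (a ^ 2)).sub (hsquares b)).mul_const ((a ^ 4 - b ^ 4) * a)⁻¹
  have hsnd := ((hsquares a).sub (hquartic.const_mul (b ^ 2))).mul_const ((a ^ 4 - b ^ 4) * b)⁻¹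
  refine (hfst.prodMk hsnd).congr_fderiv (ContinuousLinearMap.ext fun w => ?_)
  refine Prod.ext ?_ ?_
  · simp only [mul_inv_rev, Nat.add_one_sub_one, nsmul_eq_mul, Nat.cast_ofNat, smul_add, pow_one,
      ContinuousLinearMap.prod_apply, smul_apply, sub_apply, add_apply,
      ContinuousLinearMap.coe_fst', smul_eq_mul, ContinuousLinearMap.coe_snd',
      ContinuousLinearMap.id_apply, Prod.smul_fst]
    field_simp
    ring
  · simp only [mul_inv_rev, Nat.add_one_sub_one, nsmul_eq_mul, Nat.cast_ofNat, smul_add, pow_one,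
      ContinuousLinearMap.prod_apply, smul_apply, sub_apply, add_apply,
      ContinuousLinearMap.coe_fst', smul_eq_mul, ContinuousLinearMap.coe_snd',
      ContinuousLinearMap.id_apply, Prod.smul_snd]
    field_simp
    ring

section Similarity

variable {τ τ' : ℂ}

theorem thetaEven_add_mul_sub (hτ : 0 < τ.im) (x y : ℂ) :
    thetaEven τ (x + y) * thetaEven τ (x - y) =
      thetaEven (2 * τ) (2 * x) * thetaEven (2 * τ) (2 * y) +
        thetaOdd (2 * τ) (2 * x) * thetaOdd (2 * τ) (2 * y) := by
  rw [← jacobiTheta₂_add_mul_sub (two_mul_im_pos hτ), thetaEven, thetaEven, mul_add, mul_sub]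

theorem thetaOdd_add_mul_sub (hτ : 0 < τ.im) (x y : ℂ) :
    thetaOdd τ (x + y) * thetaOdd τ (x - y) =
      thetaOdd (2 * τ) (2 * x) * thetaEven (2 * τ) (2 * y) +
        thetaEven (2 * τ) (2 * x) * thetaOdd (2 * τ) (2 * y) := by
  have h := jacobiTheta₂_add_mul_sub (two_mul_im_pos hτ) (2 * x + 2 * τ / 2) (2 * y)
  rw [thetaEven_add_half_tau, thetaOdd_add_half_tau, mul_assoc (cexp _), mul_assoc (cexp _),
    ← mul_add, Complex.exp_neg, eq_inv_mul_iff_mul_eq₀ (Complex.exp_ne_zero _)] at h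
  have hexp : cexp (π * I * τ / 2 + 2 * π * I * (x + y)) *
      cexp (π * I * τ / 2 + 2 * π * I * (x - y)) =
        cexp (π * I * (2 * τ) / 2 + 2 * π * I * (2 * x)) := by
    rw [← Complex.exp_add]
    ring_nf
  rw [← h, ← hexp, thetaOdd, thetaOdd, mul_mul_mul_comm]
  ring_nf

theorem thetaDuplication_apply (hτ : 0 < τ.im) (x : ℂ) :
    thetaDuplication (thetaEven τ 0) (thetaOdd τ 0) (thetaEven τ x, thetaOdd τ x) =
      (thetaEven τ (2 * x), thetaOdd τ (2 * x)) := by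
  have hD := thetaEven_pow_four_sub_thetaOdd_pow_four_ne_zero hτ
  have hEdup := thetaEven_add_mul_sub hτ x x
  have hOdup := thetaOdd_add_mul_sub hτ x x
  have hE := thetaEven_add_mul_sub hτ x 0
  have hO := thetaOdd_add_mul_sub hτ x 0
  have hE0 := thetaEven_add_mul_sub hτ 0 0
  have hO0 := thetaOdd_add_mul_sub hτ 0 0
  have hpow_four (z : ℂ) : z ^ 4 = (z ^ 2) ^ 2 := by ring
  simp only [add_zero, sub_zero, mul_zero, sub_self, ← two_mul x, ← sq] at hEdup hOdup hE hO hE0 hO0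
  refine Prod.ext ?_ ?_
  · refine (div_eq_iff (mul_ne_zero hD (thetaEven_zero_ne_zero hτ))).mpr ?_
    rw [mul_left_comm, hEdup]
    simp only [hpow_four, hE, hO, hE0, hO0]
    ring
  · refine (div_eq_iff (mul_ne_zero hD (thetaOdd_zero_ne_zero hτ))).mpr ?_
    rw [mul_left_comm, hOdup]
    simp only [hpow_four, hE, hO, hE0, hO0]
    ring

theorem thetaDuplication_exp_mul (hτ : 0 < τ.im) {κ : ℂ} (hκ : κ ≠ 0) (ρ c x : ℂ) :
    thetaDuplication (κ * thetaEven τ 0) (κ * thetaOdd τ 0)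
        (κ * cexp (ρ * x ^ 2) * thetaEven τ (c * x), κ * cexp (ρ * x ^ 2) * thetaOdd τ (c * x)) =
      (κ * cexp (ρ * (2 * x) ^ 2) * thetaEven τ (c * (2 * x)),
        κ * cexp (ρ * (2 * x) ^ 2) * thetaOdd τ (c * (2 * x))) := by
  have hexp : cexp (ρ * (2 * x) ^ 2) = cexp (ρ * x ^ 2) ^ 4 := by
    rw [← Complex.exp_nat_mul]
    push_cast
    ring_nf
  rw [thetaDuplication_mul hκ, thetaDuplication_apply hτ, hexp, mul_left_comm c 2]
  rfl

theorem HasQuadraticTerm.thetaEven_mul_sub_ne_zero (hτ : 0 < τ.im) {α β : ℂ}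
    (hE : HasQuadraticTerm (thetaEven τ) α) (hO : HasQuadraticTerm (thetaOdd τ) β) :
    α * thetaOdd τ 0 - β * thetaEven τ 0 ≠ 0 := by
  -- Otherwise the zero of `θ` at the half period would be at least double.
  obtain ⟨k, hk, rfl, hEk⟩ := hE
  obtain ⟨l, hl, rfl, hOl⟩ := hO
  intro hkl
  set g : ℂ → ℂ := fun x => jacobiTheta₂ (x + (1 + τ) / 2) τ with hg
  have hgd : Differentiable ℂ g :=
    (differentiable_jacobiTheta₂ hτ).comp (differentiable_id.add_const _)
  have hg0 : g 0 = 0 := by simpa [hg] using jacobiTheta₂_halfPeriod hτ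
  set F : ℂ → ℂ := fun x => cexp (-(π * I * τ / 2 + 2 * π * I * x)) *
    (l x * thetaEven τ 0 - k x * thetaOdd τ 0) with hF
  have hdslope : ∀ x ∈ ({0}ᶜ : Set ℂ), dslope g 0 x ^ 2 = F x := by
    intro x hx
    have hgx := sub_smul_dslope g 0 x
    have hsq := jacobiTheta₂_add_mul_sub_halfPeriod hτ x 0
    simp only [sub_zero, hg0, smul_eq_mul, add_zero] at hgx hsq
    change g x * g x = _ at hsq
    rw [← hgx, hEk x, hOl x] at hsq
    refine mul_left_cancel₀ (pow_ne_zero 2 hx : x ^ 2 ≠ 0) ?_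
    linear_combination hsq
  have hlim : Tendsto (fun x => dslope g 0 x ^ 2) (𝓝[≠] 0) (𝓝 (dslope g 0 0 ^ 2)) :=
    (((differentiable_dslope hgd 0).continuous.pow 2).tendsto 0).mono_left nhdsWithin_le_nhds
  have hFlim : Tendsto F (𝓝[≠] 0) (𝓝 (F 0)) :=
    (show ContinuousAt F 0 by fun_prop).tendsto.mono_left nhdsWithin_le_nhds
  have h := tendsto_nhds_unique (hlim.congr' (eventually_mem_nhdsWithin.mono hdslope)) hFlim
  have hF0 : F 0 = 0 := by
    rw [hF]
    linear_combination -cexp (-(π * I * τ / 2 + 2 * π * I * 0)) * hkl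
  rw [dslope_same, hF0, sq_eq_zero_iff] at h
  exact deriv_jacobiTheta₂_halfPeriod_ne_zero hτ h

/-- The theta functions with parameters `τ` and `τ'` agree up to the dilation `x ↦ c x`, a constant
and a Gaussian factor. -/
def IsThetaSimilar (τ τ' c : ℂ) : Prop :=
  ∃ κ ρ : ℂ, κ ≠ 0 ∧ ∀ x, thetaEven τ x = κ * cexp (ρ * x ^ 2) * thetaEven τ' (c * x) ∧
    thetaOdd τ x = κ * cexp (ρ * x ^ 2) * thetaOdd τ' (c * x)

theorem isThetaSimilar_of_hasQuadraticTerm {c κ ρ α β α' β' : ℂ} (hτ : 0 < τ.im) (hτ' : 0 < τ'.im)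
    (hE : thetaEven τ 0 = κ * thetaEven τ' 0) (hO : thetaOdd τ 0 = κ * thetaOdd τ' 0)
    (hα : HasQuadraticTerm (thetaEven τ) α) (hβ : HasQuadraticTerm (thetaOdd τ) β)
    (hα' : HasQuadraticTerm (thetaEven τ') α') (hβ' : HasQuadraticTerm (thetaOdd τ') β')
    (hαα' : κ * (c ^ 2 * α' + ρ * thetaEven τ' 0) = α)
    (hββ' : κ * (c ^ 2 * β' + ρ * thetaOdd τ' 0) = β) : IsThetaSimilar τ τ' c := by
  have hE0 := thetaEven_zero_ne_zero hτ
  have hκ : κ ≠ 0 := by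
    rintro rfl
    exact hE0 (by rw [hE, zero_mul])
  set f : ℂ → ℂ × ℂ := fun x => (thetaEven τ x, thetaOdd τ x)
  set g : ℂ → ℂ × ℂ := fun x => (κ * cexp (ρ * x ^ 2) * thetaEven τ' (c * x),
    κ * cexp (ρ * x ^ 2) * thetaOdd τ' (c * x)) with hg
  have hfd : Differentiable ℂ f := (differentiable_thetaEven hτ).prodMk (differentiable_thetaOdd hτ)
  have hgd : Differentiable ℂ g := by
    have hEc := (differentiable_thetaEven hτ').comp (differentiable_id.const_mul c)
    have hOc := (differentiable_thetaOdd hτ').comp (differentiable_id.const_mul c)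
    simp only [Function.comp_def, id] at hEc hOc
    fun_prop
  have hg0 : g 0 = (thetaEven τ 0, thetaOdd τ 0) := by simp [hg, hE, hO]
  have hgdup (x : ℂ) : g (2 * x) = thetaDuplication (thetaEven τ 0) (thetaOdd τ 0) (g x) := by
    rw [hE, hO, thetaDuplication_exp_mul hτ' hκ]
  have hjet {t t' : ℂ → ℂ} {γ γ' : ℂ} (h0 : t 0 = κ * t' 0) (ht : HasQuadraticTerm t γ)
      (ht' : HasQuadraticTerm t' γ') (hγ : κ * (c ^ 2 * γ' + ρ * t' 0) = γ) :
      (fun x => t x - κ * cexp (ρ * x ^ 2) * t' (c * x)) =o[𝓝 0] fun x => x ^ 2 := by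
    have h := ((HasQuadraticTerm.exp_mul_sq ρ).mul (ht'.comp_const_mul c)).const_mul κ
    simp only [ne_eq, OfNat.ofNat_ne_zero, not_false_eq_true, zero_pow, mul_zero, Complex.exp_zero,
      one_mul, hγ, ← mul_assoc] at h
    exact ht.sub_isLittleO h (by simpa using h0)
  have hfg : f = g := eq_of_eventuallyEq_of_differentiable hfd hgd <|
    eventuallyEq_of_comp_const_mul_eq (q := 2) (m := 2) (by simp)
      (hasStrictFDerivAt_thetaDuplication hE0 (thetaOdd_zero_ne_zero hτ)
        (thetaEven_pow_four_sub_thetaOdd_pow_four_ne_zero hτ))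
      (hfd.analyticAt 0) (hgd.analyticAt 0) rfl hg0 (fun x => (thetaDuplication_apply hτ x).symm)
      hgdup ((hjet hE hα hα' hαα').prod_left (hjet hO hβ hβ' hββ'))
  exact ⟨κ, ρ, hκ, fun x => Prod.mk.inj (congrFun hfg x)⟩

theorem exists_isThetaSimilar {κ : ℂ} (hτ : 0 < τ.im) (hτ' : 0 < τ'.im)
    (hE : thetaEven τ 0 = κ * thetaEven τ' 0) (hO : thetaOdd τ 0 = κ * thetaOdd τ' 0) :
    ∃ c, c ≠ 0 ∧ IsThetaSimilar τ τ' c := by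
  obtain ⟨α, hα⟩ := HasQuadraticTerm.of_even (differentiable_thetaEven hτ) (thetaEven_neg τ)
  obtain ⟨β, hβ⟩ := HasQuadraticTerm.of_even (differentiable_thetaOdd hτ) (thetaOdd_neg τ)
  obtain ⟨α', hα'⟩ := HasQuadraticTerm.of_even (differentiable_thetaEven hτ') (thetaEven_neg τ')
  obtain ⟨β', hβ'⟩ := HasQuadraticTerm.of_even (differentiable_thetaOdd hτ') (thetaOdd_neg τ')
  have hΔ := hα.thetaEven_mul_sub_ne_zero hτ hβ
  have hΔ' := hα'.thetaEven_mul_sub_ne_zero hτ' hβ'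
  have hE0 := thetaEven_zero_ne_zero hτ
  have hE0' := thetaEven_zero_ne_zero hτ'
  have hκ : κ ≠ 0 := by
    rintro rfl
    exact hE0 (by rw [hE, zero_mul])
  -- The linear system for `(c², ρ)` that matches the quadratic terms.
  obtain ⟨c, hc⟩ := IsAlgClosed.exists_pow_nat_eq ((α * thetaOdd τ 0 - β * thetaEven τ 0) /
    (κ ^ 2 * (α' * thetaOdd τ' 0 - β' * thetaEven τ' 0))) two_pos
  rw [eq_div_iff (mul_ne_zero (pow_ne_zero 2 hκ) hΔ')] at hc
  have hc0 : c ≠ 0 := by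
    rintro rfl
    exact hΔ (by rw [← hc]; ring)
  have hρ : κ * (c ^ 2 * α' + (α - κ * c ^ 2 * α') / thetaEven τ 0 * thetaEven τ' 0) = α := by
    rw [hE]
    field_simp
    ring
  refine ⟨c, hc0, isThetaSimilar_of_hasQuadraticTerm hτ hτ' hE hO hα hβ hα' hβ' hρ ?_⟩
  rw [hE, hO] at hc
  rw [hE]
  field_simp
  refine mul_left_cancel₀ hκ ?_
  linear_combination -hc

end Similarity

section GammaFour

variable {τ τ' : ℂ}

theorem moebius_im (a b c d : ℝ) :
    ((a * τ + b) / (c * τ + d)).im = (a * d - b * c) * τ.im / normSq (c * τ + d) := by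
  rw [div_im]
  simp only [add_im, add_re, mul_im, mul_re, ofReal_re, ofReal_im]
  ring

namespace IsThetaSimilar

variable {c : ℂ}

protected theorem symm (hc : c ≠ 0) (h : IsThetaSimilar τ τ' c) : IsThetaSimilar τ' τ c⁻¹ := by
  obtain ⟨κ, ρ, hκ, h⟩ := h
  refine ⟨κ⁻¹, -(ρ / c ^ 2), inv_ne_zero hκ, fun x => ?_⟩
  have hexp : κ⁻¹ * cexp (-(ρ / c ^ 2) * x ^ 2) * (κ * cexp (ρ * (c⁻¹ * x) ^ 2)) = 1 := by
    rw [mul_mul_mul_comm, inv_mul_cancel₀ hκ, one_mul, ← Complex.exp_add, ← Complex.exp_zero]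
    congr 1
    field_simp
    ring
  obtain ⟨hE, hO⟩ := h (c⁻¹ * x)
  rw [mul_inv_cancel_left₀ hc] at hE hO
  rw [hE, hO]
  exact ⟨by rw [← mul_assoc, hexp, one_mul], by rw [← mul_assoc, hexp, one_mul]⟩

theorem exists_int_matrix (hτ : 0 < τ.im) (hτ' : 0 < τ'.im) (h : IsThetaSimilar τ τ' c) :
    ∃ p q m n : ℤ, 4 ∣ m ∧ 4 ∣ q ∧ Odd n ∧ c = m * τ' + n ∧ c * τ = p * τ' + q := by
  obtain ⟨κ, ρ, hκ, h⟩ := h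
  -- `x ↦ c * x` carries the zeros `1/4` of `thetaOdd` and `τ/4` of `thetaEven - thetaOdd` to zeros.
  have hne (x : ℂ) : κ * cexp (ρ * x ^ 2) ≠ 0 := mul_ne_zero hκ (Complex.exp_ne_zero _)
  obtain ⟨n, m, hn⟩ : ∃ n m : ℤ, c * (1 / 4) = 1 / 4 + n / 2 + m * τ' := by
    have hzero := (thetaOdd_eq_zero_iff hτ (1 / 4)).mpr ⟨0, 0, by simp⟩
    rw [(h _).2] at hzero
    exact (thetaOdd_eq_zero_iff hτ' _).mp ((mul_eq_zero.mp hzero).resolve_left (hne _))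
  obtain ⟨q, p, hq⟩ : ∃ q p : ℤ, c * (τ / 4) = τ' / 4 + q + p * (τ' / 2) := by
    have hzero := (thetaEven_sub_thetaOdd_eq_zero_iff hτ (τ / 4)).mpr ⟨0, 0, by simp⟩
    rw [(h _).1, (h _).2, ← mul_sub] at hzero
    exact (thetaEven_sub_thetaOdd_eq_zero_iff hτ' _).mp
      ((mul_eq_zero.mp hzero).resolve_left (hne _))
  refine ⟨2 * p + 1, 4 * q, 4 * m, 2 * n + 1, ⟨m, rfl⟩, ⟨q, rfl⟩, ⟨n, rfl⟩, ?_, ?_⟩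
  · push_cast
    linear_combination 4 * hn
  · push_cast
    linear_combination 4 * hq

end IsThetaSimilar

theorem im_mul_normSq_eq {c : ℂ} (hc : c ≠ 0) {p q m n : ℤ} (hmn : c = m * τ' + n)
    (hpq : c * τ = p * τ' + q) : τ.im * normSq c = (p * n - q * m : ℤ) * τ'.im := by
  have h := moebius_im (τ := τ') p q m n
  push_cast at h
  rw [← hmn, ← hpq, mul_div_cancel_left₀ _ hc, eq_div_iff (normSq_pos.mpr hc).ne'] at h
  exact_mod_cast h

theorem det_eq_one_of_inverse {c : ℂ} (hc : c ≠ 0) (hτ : 0 < τ.im) (hτ' : 0 < τ'.im)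
    {p q m n p' q' m' n' : ℤ} (hmn : c = m * τ' + n) (hpq : c * τ = p * τ' + q)
    (hmn' : c⁻¹ = m' * τ + n') (hpq' : c⁻¹ * τ' = p' * τ + q') : p * n - q * m = 1 := by
  have h := im_mul_normSq_eq hc hmn hpq
  have h' := im_mul_normSq_eq (inv_ne_zero hc) hmn' hpq'
  have hN : 0 < normSq c := normSq_pos.mpr hc
  rw [map_inv₀, ← div_eq_mul_inv, div_eq_iff hN.ne', mul_right_comm] at h'
  have hpos : 0 < p * n - q * m := by
    have := pos_of_mul_pos_left (h ▸ mul_pos hτ hN) hτ'.le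
    exact_mod_cast this
  have hmul : (p * n - q * m) * (p' * n' - q' * m') = 1 := by
    have : ((p * n - q * m : ℤ) * (p' * n' - q' * m' : ℤ) : ℝ) = 1 :=
      mul_right_cancel₀ hτ'.ne' (by linear_combination -h' - (p' * n' - q' * m' : ℤ) * h)
    exact_mod_cast this
  rcases Int.eq_one_or_neg_one_of_mul_eq_one hmul with h | h <;> omega

theorem exists_gamma_four_of_proportional {κ : ℂ} (hτ : 0 < τ.im) (hτ' : 0 < τ'.im)
    (hE : thetaEven τ 0 = κ * thetaEven τ' 0) (hO : thetaOdd τ 0 = κ * thetaOdd τ' 0) :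
    ∃ p q m n : ℤ, p * n - q * m = 1 ∧ 4 ∣ m ∧ 4 ∣ q ∧ n % 4 = 1 ∧
      τ * (m * τ' + n) = p * τ' + q := by
  obtain ⟨c, hc, h⟩ := exists_isThetaSimilar hτ hτ' hE hO
  obtain ⟨p, q, m, n, hm, hq, hn, hmn, hpq⟩ := h.exists_int_matrix hτ hτ'
  obtain ⟨p', q', m', n', -, -, -, hmn', hpq'⟩ := (h.symm hc).exists_int_matrix hτ' hτ
  have hdet := det_eq_one_of_inverse hc hτ hτ' hmn hpq hmn' hpq'
  rw [hmn, mul_comm] at hpq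
  rw [Int.odd_iff] at hn
  obtain hn | hn : n % 4 = 1 ∨ n % 4 = 3 := by omega
  · exact ⟨p, q, m, n, hdet, hm, hq, hn, hpq⟩
  · refine ⟨-p, -q, -m, -n, by linear_combination hdet, hm.neg_right, hq.neg_right, by omega, ?_⟩
    push_cast
    linear_combination -hpq

end GammaFour

section SquareRoot

variable {x y z w : ℂ}

theorem csqrt_sq (w : ℂ) : w.sqrt ^ 2 = w := by
  simp [Complex.sqrt]

theorem csqrt_ne_zero (hw : w ≠ 0) : w.sqrt ≠ 0 := by
  contrapose! hw
  rw [← csqrt_sq w, hw, zero_pow two_ne_zero]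

theorem csqrt_re_nonneg (w : ℂ) : 0 ≤ w.sqrt.re := by
  rw [Complex.sqrt, cpow_inv_two_re]
  positivity

theorem csqrt_eq_of_sq_eq (h : z ^ 2 = w) (hz : 0 < z.re) : w.sqrt = z := by
  rw [← h, Complex.sqrt, sq_cpow_two_inv hz]

theorem two_mul_csqrt_re_mul_im (w : ℂ) : 2 * (w.sqrt.re * w.sqrt.im) = w.im := by
  have h := congrArg Complex.im (csqrt_sq w)
  rw [sq, mul_im] at h
  linarith

theorem csqrt_re_pos_and_im_pos (h : 0 < w.im) : 0 < w.sqrt.re ∧ 0 < w.sqrt.im := by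
  have hmul : 0 < w.sqrt.re * w.sqrt.im := by linarith [two_mul_csqrt_re_mul_im w]
  have him := pos_of_mul_pos_right hmul (csqrt_re_nonneg w)
  exact ⟨pos_of_mul_pos_left hmul him.le, him⟩

theorem csqrt_conj (h : w.im ≠ 0) : (starRingEnd ℂ w).sqrt = starRingEnd ℂ w.sqrt := by
  refine csqrt_eq_of_sq_eq (by rw [← map_pow, csqrt_sq]) ?_
  rw [conj_re]
  refine (csqrt_re_nonneg w).lt_of_ne' fun h0 => h ?_
  rw [← two_mul_csqrt_re_mul_im, h0, zero_mul, mul_zero]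

theorem csqrt_re_pos_and_im_neg (h : w.im < 0) : 0 < w.sqrt.re ∧ w.sqrt.im < 0 := by
  have hconj := csqrt_re_pos_and_im_pos (w := starRingEnd ℂ w) (by simpa using h)
  rwa [csqrt_conj h.ne, conj_re, conj_im, Left.neg_pos_iff] at hconj

theorem csqrt_mul_of_im_pos_of_im_neg (hx : 0 < x.im) (hy : y.im < 0) :
    (x * y).sqrt = x.sqrt * y.sqrt := by
  refine csqrt_eq_of_sq_eq (by rw [mul_pow, csqrt_sq, csqrt_sq]) ?_
  obtain ⟨hxre, hxim⟩ := csqrt_re_pos_and_im_pos hx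
  obtain ⟨hyre, hyim⟩ := csqrt_re_pos_and_im_neg hy
  rw [mul_re]
  nlinarith [mul_pos hxre hyre]

theorem csqrt_mul_of_im_pos (hx : 0 < x.im) (hy : 0 < y.im) (hxy : 0 < (x * y).im) :
    (x * y).sqrt = x.sqrt * y.sqrt := by
  have hsq : (x.sqrt * y.sqrt) ^ 2 = x * y := by rw [mul_pow, csqrt_sq, csqrt_sq]
  obtain ⟨hxre, hxim⟩ := csqrt_re_pos_and_im_pos hx
  obtain ⟨hyre, hyim⟩ := csqrt_re_pos_and_im_pos hy
  have him : 0 < (x.sqrt * y.sqrt).im := by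
    rw [mul_im]
    positivity
  rw [← hsq, sq, mul_im] at hxy
  exact csqrt_eq_of_sq_eq hsq (by nlinarith)

theorem csqrt_mul_of_im_neg (hx : x.im < 0) (hy : y.im < 0) (hxy : 0 < (x * y).im) :
    (x * y).sqrt = -(x.sqrt * y.sqrt) := by
  have hsq : (x.sqrt * y.sqrt) ^ 2 = x * y := by rw [mul_pow, csqrt_sq, csqrt_sq]
  obtain ⟨hxre, hxim⟩ := csqrt_re_pos_and_im_neg hx
  obtain ⟨hyre, hyim⟩ := csqrt_re_pos_and_im_neg hy
  have him : (x.sqrt * y.sqrt).im < 0 := by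
    rw [mul_im]
    nlinarith [mul_pos hxre (neg_pos.mpr hyim), mul_pos hyre (neg_pos.mpr hxim)]
  rw [← hsq, sq, mul_im] at hxy
  refine csqrt_eq_of_sq_eq (by rw [neg_sq, hsq]) ?_
  rw [neg_re]
  nlinarith

theorem abs_im_lt_re_of_sq_re_pos (h : 0 < (w ^ 2).re) (hw : 0 ≤ w.re) : |w.im| < w.re := by
  rw [sq, mul_re] at h
  exact abs_lt_of_sq_lt_sq (by nlinarith) hw

theorem csqrt_div_of_re_pos (hx : 0 < x.re) (hy : 0 < y.re) :
    (x / y).sqrt = x.sqrt / y.sqrt := by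
  have hy0 : y.sqrt ≠ 0 := csqrt_ne_zero (by rintro rfl; exact hy.false)
  refine csqrt_eq_of_sq_eq (by rw [div_pow, csqrt_sq, csqrt_sq]) ?_
  have hxim := abs_lt.mp (abs_im_lt_re_of_sq_re_pos ((csqrt_sq x).symm ▸ hx) (csqrt_re_nonneg x))
  have hyim := abs_lt.mp (abs_im_lt_re_of_sq_re_pos ((csqrt_sq y).symm ▸ hy) (csqrt_re_nonneg y))
  rw [div_re, ← add_div]
  exact div_pos (by nlinarith) (normSq_pos.mpr hy0)

end SquareRoot

section Generators

variable {τ : ℂ}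

theorem jacobiTheta₂_add_int_mul_two (z τ : ℂ) (n : ℤ) :
    jacobiTheta₂ z (τ + n * 2) = jacobiTheta₂ z τ :=
  Function.Periodic.int_mul (jacobiTheta₂_add_right z) n τ

theorem thetaEven_add_int (τ : ℂ) (n : ℤ) : thetaEven (τ + n) 0 = thetaEven τ 0 := by
  rw [thetaEven, thetaEven, ← jacobiTheta₂_add_int_mul_two (2 * 0) (2 * τ) n]
  ring_nf

theorem thetaOdd_add_int (τ : ℂ) (n : ℤ) : thetaOdd (τ + n) 0 = I ^ n * thetaOdd τ 0 := by
  have hI : (I : ℂ) ^ n = cexp (n * (π / 2 * I)) := by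
    rw [Complex.exp_int_mul, Complex.exp_pi_div_two_mul_I]
  rw [hI, thetaOdd, thetaOdd, show 2 * (τ + n) = 2 * τ + n * 2 by ring,
    jacobiTheta₂_add_int_mul_two, show 2 * 0 + (τ + n) = 2 * 0 + τ + n by ring,
    jacobiTheta₂_add_int, ← mul_assoc, ← Complex.exp_add]
  ring_nf

theorem neg_one_div_im_pos (hτ : 0 < τ.im) : 0 < (-1 / τ).im := by
  rw [neg_div, neg_im, one_div, inv_im, neg_div, neg_neg]
  exact div_pos hτ (normSq_pos.mpr (by rintro rfl; exact hτ.false))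

theorem thetaEven_inversion (hτ : 0 < τ.im) :
    thetaEven τ 0 = 1 / (-I * (2 * τ)).sqrt * (thetaEven (-1 / τ) 0 + thetaOdd (-1 / τ) 0) := by
  have hhalf : -1 / (2 * τ) = -1 / τ / 2 := by field_simp
  rw [thetaEven, mul_zero, jacobiTheta₂_functional_equation, hhalf, zero_div,
    jacobiTheta₂_half_eq (neg_one_div_im_pos hτ), Complex.sqrt]
  simp

theorem thetaOdd_inversion (hτ : 0 < τ.im) :
    thetaOdd τ 0 = 1 / (-I * (2 * τ)).sqrt * (thetaEven (-1 / τ) 0 - thetaOdd (-1 / τ) 0) := by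
  have hτ0 : τ ≠ 0 := by rintro rfl; exact hτ.false
  have hhalf : -1 / (2 * τ) = -1 / τ / 2 := by field_simp
  have hexp : cexp (π * I * τ / 2 + 2 * π * I * 0) *
      cexp (-π * I * (2 * 0 + τ) ^ 2 / (2 * τ)) = 1 := by
    rw [← Complex.exp_add, ← Complex.exp_zero]
    congr 1
    field_simp
    ring
  rw [thetaOdd, jacobiTheta₂_functional_equation, hhalf,
    show (2 * 0 + τ) / (2 * τ) = 0 + 1 / 2 by field_simp; ring,
    jacobiTheta₂_half_add_half_eq (neg_one_div_im_pos hτ), Complex.sqrt, one_div (2 : ℂ)]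
  linear_combination (1 / (-I * (2 * τ)) ^ (2⁻¹ : ℂ)) *
    (thetaEven (-1 / τ) 0 - thetaOdd (-1 / τ) 0) * hexp

theorem four_mul_int_mul_add_one_ne_zero (hτ : 0 < τ.im) (n : ℤ) : 4 * n * τ + 1 ≠ 0 := by
  intro h
  have him : 4 * (n : ℝ) * τ.im = 0 := by simpa [mul_assoc] using congrArg Complex.im h
  have hn : (n : ℂ) = 0 := by
    rw [mul_eq_zero, or_iff_left hτ.ne', mul_eq_zero, or_iff_right four_ne_zero] at him
    exact_mod_cast him
  simp [hn] at h

theorem div_four_mul_int_mul_add_one_im_pos (hτ : 0 < τ.im) (n : ℤ) :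
    0 < (τ / (4 * n * τ + 1)).im := by
  have h := moebius_im (τ := τ) 1 0 (4 * n) 1
  push_cast at h
  rw [one_mul, add_zero, mul_one, zero_mul, sub_zero, one_mul] at h
  rw [h]
  exact div_pos hτ (normSq_pos.mpr (four_mul_int_mul_add_one_ne_zero hτ n))

theorem theta_lower_unipotent (hτ : 0 < τ.im) (n : ℤ) :
    thetaEven (τ / (4 * n * τ + 1)) 0 = (4 * n * τ + 1).sqrt * thetaEven τ 0 ∧
      thetaOdd (τ / (4 * n * τ + 1)) 0 = (4 * n * τ + 1).sqrt * thetaOdd τ 0 := by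
  have hden := four_mul_int_mul_add_one_ne_zero hτ n
  have hpos := div_four_mul_int_mul_add_one_im_pos hτ n
  have hτ0 : τ ≠ 0 := by rintro rfl; exact hτ.false
  set σ := τ / (4 * n * τ + 1) with hσ
  have hinv : -1 / σ = -1 / τ + ((-4 * n : ℤ) : ℂ) := by
    rw [hσ]
    push_cast
    field_simp
    ring
  have hI : (I : ℂ) ^ (-4 * n : ℤ) = 1 := by
    rw [zpow_mul, zpow_neg, zpow_ofNat, I_pow_four, inv_one, one_zpow]
  have hre {ζ : ℂ} (hζ : 0 < ζ.im) : 0 < (-I * (2 * ζ)).re := by simpa using hζ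
  have hsqrt : (4 * n * τ + 1).sqrt = (-I * (2 * τ)).sqrt / (-I * (2 * σ)).sqrt := by
    rw [← csqrt_div_of_re_pos (hre hτ) (hre hpos), hσ]
    have := I_ne_zero
    congr 1
    field_simp
  have hτsqrt : (-I * (2 * τ)).sqrt ≠ 0 := csqrt_ne_zero (by simp [hτ0])
  rw [hsqrt, thetaEven_inversion hpos, thetaOdd_inversion hpos, thetaEven_inversion hτ,
    thetaOdd_inversion hτ, hinv, thetaEven_add_int, thetaOdd_add_int, hI, one_mul]
  generalize (-I * (2 * τ)).sqrt = r at *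
  constructor <;> field_simp

theorem thetaEven_conj (τ : ℂ) :
    thetaEven (-starRingEnd ℂ τ) 0 = starRingEnd ℂ (thetaEven τ 0) := by
  rw [thetaEven, thetaEven, jacobiTheta₂_conj]
  simp [map_ofNat]

theorem thetaOdd_conj (τ : ℂ) :
    thetaOdd (-starRingEnd ℂ τ) 0 = starRingEnd ℂ (thetaOdd τ 0) := by
  rw [thetaOdd, thetaOdd, map_mul, jacobiTheta₂_conj, ← Complex.exp_conj,
    ← jacobiTheta₂_neg_left]
  simp [map_ofNat]

end Generators

section JacobiSymbol

theorem jacobiSym_eq_of_dvd_add_of_odd {m x y : ℕ} (hm : Odd m) (hx : Odd x) (hy : Odd y)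
    (h : 4 * m ∣ x + y) : J(m | x) = J(m | y) := by
  have hxy : J(x | m) = J(-1 | m) * J(y | m) := by
    rw [← jacobiSym.mul_left]
    have hdvd : (m : ℤ) ∣ x + y := by exact_mod_cast (dvd_mul_left m 4).trans h
    refine jacobiSym.mod_left' (Int.ModEq.symm (Int.modEq_iff_dvd.mpr ?_))
    rwa [neg_one_mul, sub_neg_eq_add]
  have h4 : 4 ∣ x + y := (dvd_mul_right 4 m).trans h
  have hm2 : m % 2 = 1 := Nat.odd_iff.mp hm
  have hx2 : x % 2 = 1 := Nat.odd_iff.mp hx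
  have hy2 : y % 2 = 1 := Nat.odd_iff.mp hy
  rw [← jacobiSym.quadratic_reciprocity_if hm2 hx2, ← jacobiSym.quadratic_reciprocity_if hm2 hy2,
    hxy, jacobiSym.at_neg_one hm]
  rcases Nat.odd_mod_four_iff.mp hm2 with hm4 | hm4
  · simp [hm4, ZMod.χ₄_nat_one_mod_four hm4]
  · obtain ⟨hx4, hy4⟩ | ⟨hx4, hy4⟩ : x % 4 = 1 ∧ y % 4 = 3 ∨ x % 4 = 3 ∧ y % 4 = 1 := by omega
    all_goals simp [hm4, hx4, hy4, ZMod.χ₄_nat_three_mod_four hm4]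

theorem jacobiSym_eq_of_dvd_add {m x y : ℕ} (hm0 : m ≠ 0) (hx : Odd x) (hy : Odd y)
    (h : 4 * m ∣ x + y) : J(m | x) = J(m | y) := by
  induction m using Nat.strong_induction_on with
  | _ m ih =>
    rcases Nat.even_or_odd' m with ⟨r, rfl | rfl⟩
    · have hr := ih r (by omega) (by omega) (Dvd.dvd.trans ⟨2, by ring⟩ h)
      have h8 : 8 ∣ x + y := Dvd.dvd.trans ⟨r, by ring⟩ h
      have hx2 := Nat.odd_iff.mp hx
      have hy2 := Nat.odd_iff.mp hy
      have hmod : (x % 8 = 1 ∨ x % 8 = 7) ↔ (y % 8 = 1 ∨ y % 8 = 7) := by omega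
      have htwo : J(2 | x) = J(2 | y) := by
        rw [jacobiSym.at_two hx, jacobiSym.at_two hy, ZMod.χ₈_nat_eq_if_mod_eight,
          ZMod.χ₈_nat_eq_if_mod_eight, if_neg (by omega : ¬x % 2 = 0),
          if_neg (by omega : ¬y % 2 = 0)]
        simp only [hmod]
      push_cast
      rw [jacobiSym.mul_left, jacobiSym.mul_left, hr, htwo]
    · exact jacobiSym_eq_of_dvd_add_of_odd ⟨r, rfl⟩ hx hy h

theorem jacobiSym_natAbs_eq_of_dvd_sub {c δ δ' : ℤ} (hc : 0 < c) (h4 : 4 ∣ c) (hδ : Odd δ)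
    (hδ' : Odd δ') (h : c ∣ δ - δ') : J(c | δ.natAbs) = J(c | δ'.natAbs) := by
  obtain ⟨m, rfl⟩ := h4
  lift m to ℕ using by omega
  rw [← Int.natAbs_odd] at hδ hδ'
  have hsame {x y : ℕ} (hx : Odd x) (hy : Odd y) (hxy : (4 * m : ℤ) ∣ x - y) :
      J(m | x) = J(m | y) := by
    rw [jacobiSym.mod_right' m hx, jacobiSym.mod_right' m hy]
    congr 1
    exact Nat.modEq_iff_dvd.mpr (by push_cast; exact dvd_sub_comm.mp hxy)
  rw [jacobiSym.mul_left, jacobiSym.mul_left, jacobiSym.at_four hδ, jacobiSym.at_four hδ']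
  congr 1
  have hdvd : (4 * m : ℤ) ∣ δ.natAbs - δ'.natAbs ∨ (4 * m : ℤ) ∣ δ.natAbs + δ'.natAbs := by
    rcases Int.natAbs_eq δ with e | e <;> rcases Int.natAbs_eq δ' with e' | e' <;>
      rw [e, e'] at h
    · exact .inl h
    · exact .inr (by simpa using h)
    · exact .inr (by simpa [add_comm] using h.neg_right)
    · exact .inl (by simpa [sub_eq_add_neg, add_comm] using h.neg_right)
  rcases hdvd with hdvd | hdvd
  · exact hsame hδ hδ' hdvd
  · exact jacobiSym_eq_of_dvd_add (by omega) hδ hδ' (by exact_mod_cast hdvd)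

theorem jacobiSym_abs_of_one_mod_four {n : ℕ} (hn : n % 4 = 1) (c : ℤ) : J(|c| | n) = J(c | n) := by
  rcases abs_choice c with h | h <;> rw [h]
  have hodd : Odd n := Nat.odd_iff.mpr (by omega)
  rw [← neg_one_mul, jacobiSym.mul_left, jacobiSym.at_neg_one hodd, ZMod.χ₄_nat_one_mod_four hn,
    one_mul]

theorem jacobiSym_neg_of_three_mod_four {n : ℕ} (hn : n % 4 = 3) (c : ℤ) :
    J(-c | n) = -J(c | n) := by
  have hodd : Odd n := Nat.odd_iff.mpr (by omega)
  rw [← neg_one_mul, jacobiSym.mul_left, jacobiSym.at_neg_one hodd,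
    ZMod.χ₄_nat_three_mod_four hn, neg_one_mul]

theorem jacobiSym_sub_mul_natAbs (a b n : ℤ) : J(a - n * b | b.natAbs) = J(a | b.natAbs) :=
  jacobiSym.mod_left' (Int.modEq_iff_dvd.mpr
    (Int.natAbs_dvd.mpr ⟨n, by ring⟩))

end JacobiSymbol

section Transformation

theorem I_zpow_eq_of_four_dvd {m n : ℤ} (h : 4 ∣ m - n) : (I : ℂ) ^ m = I ^ n := by
  obtain ⟨k, hk⟩ := h
  rw [show m = n + 4 * k by omega, zpow_add₀ I_ne_zero, zpow_mul, zpow_ofNat, I_pow_four,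
    one_zpow, mul_one]

theorem intCast_mul_add_intCast_im (c δ : ℤ) (τ : ℂ) : ((c : ℂ) * τ + δ).im = c * τ.im := by
  simp

/-- The theta constants transform under `τ ↦ (α τ + β) / (c τ + δ)` with multiplier
`(|c| / |δ|) √(c τ + δ)`, up to a fourth root of unity for the odd part. -/
def ThetaTransforms (α β c δ : ℤ) : Prop :=
  ∀ τ : ℂ, 0 < τ.im →
    thetaEven ((α * τ + β) / (c * τ + δ)) 0 =
      (J(|c| | δ.natAbs) : ℂ) * (c * τ + δ).sqrt * thetaEven τ 0 ∧
    thetaOdd ((α * τ + β) / (c * τ + δ)) 0 =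
      I ^ β * ((J(|c| | δ.natAbs) : ℂ) * (c * τ + δ).sqrt * thetaOdd τ 0)

namespace ThetaTransforms

variable {α β c δ n : ℤ} {τ : ℂ}

theorem translation (β : ℤ) : ThetaTransforms 1 β 0 1 := by
  intro τ _
  simp [thetaEven_add_int, thetaOdd_add_int]

theorem of_conj (hc : c ≠ 0) (h : ThetaTransforms α (-β) (-c) δ) : ThetaTransforms α β c δ := by
  intro τ hτ
  have him : ((c : ℂ) * τ + δ).im ≠ 0 := by
    rw [intCast_mul_add_intCast_im]
    exact mul_ne_zero (Int.cast_ne_zero.mpr hc) hτ.ne'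
  obtain ⟨hE, hO⟩ := h (-starRingEnd ℂ τ) (by simpa using hτ)
  have hden : ((-c : ℤ) : ℂ) * (-starRingEnd ℂ τ) + δ = starRingEnd ℂ (c * τ + δ) := by simp
  have hnum : (α : ℂ) * (-starRingEnd ℂ τ) + ((-β : ℤ) : ℂ) = -starRingEnd ℂ (α * τ + β) := by
    simp only [Int.cast_neg, map_add, map_mul, map_intCast]
    ring
  have hI : (I : ℂ) ^ (-β) = starRingEnd ℂ (I ^ β) := by
    rw [map_zpow₀, conj_I, zpow_neg, ← inv_zpow, inv_I]
  rw [hden, hnum, neg_div, ← map_div₀, csqrt_conj him, abs_neg, thetaEven_conj,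
    thetaEven_conj] at hE
  rw [hden, hnum, neg_div, ← map_div₀, csqrt_conj him, abs_neg, thetaOdd_conj,
    thetaOdd_conj, hI] at hO
  constructor <;> apply (starRingEnd ℂ).injective
  · simpa using hE
  · simpa using hO

theorem of_translation (k : ℤ) (hα : 4 ∣ α - 1)
    (hJ : J(|c| | (δ - k * c).natAbs) = J(|c| | δ.natAbs))
    (h : ThetaTransforms α (β - k * α) c (δ - k * c)) : ThetaTransforms α β c δ := by
  intro τ hτ
  obtain ⟨hE, hO⟩ := h (τ + k) (by simpa using hτ)
  have hden : (c : ℂ) * (τ + k) + ((δ - k * c : ℤ) : ℂ) = c * τ + δ := by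
    push_cast
    ring
  have hnum : (α : ℂ) * (τ + k) + ((β - k * α : ℤ) : ℂ) = α * τ + β := by
    push_cast
    ring
  have hI : (I : ℂ) ^ β = I ^ (β - k * α) * I ^ k := by
    rw [← zpow_add₀ I_ne_zero]
    apply I_zpow_eq_of_four_dvd
    obtain ⟨r, hr⟩ := hα
    exact ⟨k * r, by linear_combination k * hr⟩
  rw [hden, hnum, hJ, thetaEven_add_int] at hE
  rw [hden, hnum, hJ, thetaOdd_add_int] at hO
  refine ⟨hE, ?_⟩
  rw [hO, hI]
  ring

theorem of_lower_unipotent (n : ℤ)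
    (hmul : ∀ τ : ℂ, 0 < τ.im →
      (J(|c - 4 * n * δ| | δ.natAbs) : ℂ) * ((c * τ + δ) / (4 * n * τ + 1)).sqrt *
        (4 * n * τ + 1).sqrt = (J(|c| | δ.natAbs) : ℂ) * (c * τ + δ).sqrt)
    (h : ThetaTransforms (α - 4 * n * β) β (c - 4 * n * δ) δ) : ThetaTransforms α β c δ := by
  intro τ hτ
  have h0 := four_mul_int_mul_add_one_ne_zero hτ n
  obtain ⟨hE, hO⟩ := h _ (div_four_mul_int_mul_add_one_im_pos hτ n)
  have hden : ((c - 4 * n * δ : ℤ) : ℂ) * (τ / (4 * n * τ + 1)) + δ =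
      (c * τ + δ) / (4 * n * τ + 1) := by
    push_cast
    field_simp
    ring
  have hnum : ((α - 4 * n * β : ℤ) : ℂ) * (τ / (4 * n * τ + 1)) + β =
      (α * τ + β) / (4 * n * τ + 1) := by
    push_cast
    field_simp
    ring
  rw [hnum, hden, div_div_div_cancel_right₀ h0, (theta_lower_unipotent hτ n).1] at hE
  rw [hnum, hden, div_div_div_cancel_right₀ h0, (theta_lower_unipotent hτ n).2] at hO
  rw [hE, hO, ← hmul τ hτ]
  constructor <;> ring

theorem denominator_im (c δ n : ℤ) (τ : ℂ) :
    ((c * τ + δ) / (4 * n * τ + 1)).im =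
      (c - 4 * n * δ : ℤ) * (τ.im / normSq (4 * n * τ + 1)) := by
  have h := moebius_im (τ := τ) c δ (4 * n) 1
  push_cast at h ⊢
  rw [h]
  ring

theorem im_div_normSq_pos (hτ : 0 < τ.im) (n : ℤ) : 0 < τ.im / normSq (4 * n * τ + 1) :=
  div_pos hτ (normSq_pos.mpr (four_mul_int_mul_add_one_ne_zero hτ n))

theorem of_lower_unipotent_of_pos (hn : 0 < n) (hc : 0 < c) (hδ : 0 < δ) (hδ4 : δ % 4 = 1)
    (hdet : α * δ - β * c = 1) (h : ThetaTransforms (α - 4 * n * β) β (c - 4 * n * δ) δ) :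
    ThetaTransforms α β c δ := by
  refine of_lower_unipotent n (fun τ hτ => ?_) h
  have hmod : δ.natAbs % 4 = 1 := by omega
  rw [jacobiSym_abs_of_one_mod_four hmod, jacobiSym_abs_of_one_mod_four hmod,
    jacobiSym_sub_mul_natAbs, mul_assoc]
  congr 1
  have h0 := four_mul_int_mul_add_one_ne_zero hτ n
  have him := denominator_im c δ n τ
  have hpos := im_div_normSq_pos hτ n
  have hn' : (0 : ℝ) < n := by exact_mod_cast hn
  have hy : 0 < (4 * n * τ + 1 : ℂ).im := by simpa [mul_assoc] using mul_pos hn' hτ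
  have hxy : 0 < ((c * τ + δ) / (4 * n * τ + 1) * (4 * n * τ + 1)).im := by
    rw [div_mul_cancel₀ _ h0, intCast_mul_add_intCast_im]
    exact mul_pos (by exact_mod_cast hc) hτ
  conv_rhs => rw [← div_mul_cancel₀ (c * τ + δ) h0]
  rcases lt_trichotomy (c - 4 * n * δ) 0 with hs | hs | hs
  · rw [mul_comm, mul_comm (_ / _), csqrt_mul_of_im_pos_of_im_neg hy]
    rw [him]
    exact mul_neg_of_neg_of_pos (by exact_mod_cast hs) hpos
  · have hδ1 : δ = 1 := by
      have hinv : (α - 4 * n * β) * δ = 1 := by linear_combination hdet + β * hs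
      rcases Int.eq_one_or_neg_one_of_mul_eq_one' hinv with h | h <;> omega
    have hc4 : c = 4 * n := by rw [hδ1] at hs; linarith
    simp [hδ1, hc4, h0]
  · rw [csqrt_mul_of_im_pos _ hy hxy]
    rw [him]
    exact mul_pos (by exact_mod_cast hs) hpos

theorem of_lower_unipotent_of_neg (hn : n < 0) (hc : 0 < c) (hδ : δ < 0) (hδ4 : δ % 4 = 1)
    (hdet : α * δ - β * c = 1) (h : ThetaTransforms (α - 4 * n * β) β (c - 4 * n * δ) δ) :
    ThetaTransforms α β c δ := by
  refine of_lower_unipotent n (fun τ hτ => ?_) h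
  have hmod : δ.natAbs % 4 = 3 := by omega
  have h0 := four_mul_int_mul_add_one_ne_zero hτ n
  have him := denominator_im c δ n τ
  have hpos := im_div_normSq_pos hτ n
  have hn' : (n : ℝ) < 0 := by exact_mod_cast hn
  have hy : (4 * n * τ + 1 : ℂ).im < 0 := by
    simpa [mul_assoc] using mul_neg_of_pos_of_neg four_pos (mul_neg_of_neg_of_pos hn' hτ)
  have hxy : 0 < ((c * τ + δ) / (4 * n * τ + 1) * (4 * n * τ + 1)).im := by
    rw [div_mul_cancel₀ _ h0, intCast_mul_add_intCast_im]
    exact mul_pos (by exact_mod_cast hc) hτ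
  conv_rhs => rw [← div_mul_cancel₀ (c * τ + δ) h0]
  rw [abs_of_pos hc, mul_assoc]
  rcases lt_trichotomy (c - 4 * n * δ) 0 with hs | hs | hs
  · rw [abs_of_neg hs, jacobiSym_neg_of_three_mod_four hmod, jacobiSym_sub_mul_natAbs,
      csqrt_mul_of_im_neg _ hy hxy, Int.cast_neg, neg_mul, mul_neg]
    rw [him]
    exact mul_neg_of_neg_of_pos (by exact_mod_cast hs) hpos
  · have hinv : (α - 4 * n * β) * δ = 1 := by linear_combination hdet + β * hs
    rcases Int.eq_one_or_neg_one_of_mul_eq_one' hinv with h | h <;> omega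
  · rw [abs_of_pos hs, jacobiSym_sub_mul_natAbs, csqrt_mul_of_im_pos_of_im_neg _ hy]
    rw [him]
    exact mul_pos (by exact_mod_cast hs) hpos

/- Euclidean descent on `c`: translate `δ` into `[-c/2, c/2]`, then subtract `±4 δ` from `c`. -/
theorem of_natAbs_lt (hdet : α * δ - β * c = 1) (hc : 4 ∣ c) (hδ : δ % 4 = 1) (hpos : 0 < c)
    (ih : ∀ α' β' c' δ' : ℤ, c'.natAbs < c.natAbs → α' * δ' - β' * c' = 1 → 4 ∣ c' → δ' % 4 = 1 →
      ThetaTransforms α' β' c' δ') : ThetaTransforms α β c δ := by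
  obtain ⟨m, rfl⟩ := hc
  have hα : 4 ∣ α - 1 := by
    obtain ⟨r, rfl⟩ : ∃ r, δ = 4 * r + 1 := ⟨δ / 4, by omega⟩
    exact ⟨β * m - α * r, by linear_combination hdet⟩
  obtain ⟨k, hlower, hupper⟩ :
      ∃ k : ℤ, -(2 * m) ≤ δ - k * (4 * m) ∧ δ - k * (4 * m) ≤ 2 * m := by
    refine ⟨(δ + 2 * m) / (4 * m), ?_, ?_⟩
    · linarith [Int.mul_ediv_self_le (x := δ + 2 * m) hpos.ne']
    · linarith [Int.lt_mul_ediv_self_add (x := δ + 2 * m) hpos]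
  have hδ' : (δ - k * (4 * m)) % 4 = 1 := by
    rw [show δ - k * (4 * m) = δ - 4 * (k * m) by ring]
    omega
  refine of_translation k hα ?_ ?_
  · rw [abs_of_pos hpos]
    exact jacobiSym_natAbs_eq_of_dvd_sub hpos ⟨m, rfl⟩ (Int.odd_iff.mpr (by omega))
      (Int.odd_iff.mpr (by omega)) ⟨-k, by ring⟩
  have hdet' : α * (δ - k * (4 * m)) - (β - k * α) * (4 * m) = 1 := by linear_combination hdet
  generalize δ - k * (4 * m) = δ' at *
  generalize β - k * α = β' at *
  rcases lt_trichotomy δ' 0 with hs | rfl | hs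
  · exact of_lower_unipotent_of_neg (n := -1) (by decide) hpos hs hδ' hdet' <|
      ih _ _ _ _ (by omega) (by linear_combination hdet') ⟨m + δ', by ring⟩ hδ'
  · omega
  · exact of_lower_unipotent_of_pos (n := 1) (by decide) hpos hs hδ' hdet' <|
      ih _ _ _ _ (by omega) (by linear_combination hdet') ⟨m - δ', by ring⟩ hδ'

end ThetaTransforms

theorem thetaTransforms_of_det_eq_one {α β c δ : ℤ} (hdet : α * δ - β * c = 1) (hc : 4 ∣ c)
    (hδ : δ % 4 = 1) : ThetaTransforms α β c δ := by
  induction hN : c.natAbs using Nat.strong_induction_on generalizing α β c δ with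
  | _ N ih =>
    subst hN
    rcases lt_trichotomy c 0 with hs | rfl | hs
    · refine .of_conj hs.ne (.of_natAbs_lt (by linear_combination hdet) hc.neg_right hδ
        (neg_pos.mpr hs) fun α' β' c' δ' hlt hdet' hc' hδ' => ?_)
      exact ih _ (by rwa [Int.natAbs_neg] at hlt) hdet' hc' hδ' rfl
    · obtain rfl : δ = 1 := by
        have hinv : α * δ = 1 := by linear_combination hdet
        rcases Int.eq_one_or_neg_one_of_mul_eq_one' hinv with h | h <;> omega
      obtain rfl : α = 1 := by linarith
      exact .translation β
    · exact .of_natAbs_lt hdet hc hδ hs fun α' β' c' δ' hlt hdet' hc' hδ' =>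
        ih _ hlt hdet' hc' hδ' rfl

end Transformation

section Criticality

variable {d : ℕ} [NeZero d] {τ lam : ℂ}

theorem sum_zmod_val_eq_sum_range (d : ℕ) [NeZero d] (g : ℕ → ℂ) :
    ∑ s : ZMod d, g s.val = ∑ s ∈ Finset.range d, g s := by
  obtain ⟨n, rfl⟩ := Nat.exists_eq_succ_of_ne_zero (NeZero.ne d)
  exact Fin.sum_univ_eq_sum_range g (n + 1)

theorem sum_thetaEven_div_and_sum_thetaOdd_div (hd : Odd d) (hτ : 0 < τ.im) :
    ∑ s ∈ Finset.range d, thetaEven τ (s / d) = d * thetaEven ((d : ℂ) ^ 2 * τ) 0 ∧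
      ∑ s ∈ Finset.range d, thetaOdd τ (s / d) = d * thetaOdd ((d : ℂ) ^ 2 * τ) 0 := by
  obtain ⟨k, hk⟩ := hd
  have hdτ := natCast_sq_mul_im_pos hτ d
  have hhalf : (d : ℂ) * (1 / 2) = 0 + 1 / 2 + (k : ℤ) := by
    rw [hk]
    push_cast
    ring
  have hsum := sum_jacobiTheta₂_add_div (half_im_pos hτ) d 0
  have hdiff := sum_jacobiTheta₂_add_div (half_im_pos hτ) d (1 / 2)
  rw [← mul_div_assoc, mul_zero, jacobiTheta₂_half_eq hdτ] at hsum
  rw [← mul_div_assoc ((d : ℂ) ^ 2), hhalf, jacobiTheta₂_add_int,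
    jacobiTheta₂_half_add_half_eq hdτ] at hdiff
  simp only [zero_add, jacobiTheta₂_half_eq hτ, Finset.sum_add_distrib] at hsum
  simp only [add_comm (1 / 2 : ℂ), jacobiTheta₂_half_add_half_eq hτ,
    Finset.sum_sub_distrib] at hdiff
  constructor
  · linear_combination (hsum + hdiff) / 2
  · linear_combination (hsum - hdiff) / 2

theorem sum_thetaSample (hd : Odd d) (hτ : 0 < τ.im) (z : ℂ) (t : ZMod d) :
    ∑ s : ZMod d, thetaSample d τ z s * thetaSample d τ z (2 • t - s) =
      thetaEven τ (z + t.val / d) * (d * thetaEven ((d : ℂ) ^ 2 * τ) 0) +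
        thetaOdd τ (z + t.val / d) * (d * thetaOdd ((d : ℂ) ^ 2 * τ) 0) := by
  obtain ⟨hE, hO⟩ := sum_thetaEven_div_and_sum_thetaOdd_div hd hτ
  rw [← hE, ← hO, Finset.mul_sum, Finset.mul_sum, ← Finset.sum_add_distrib,
    ← sum_zmod_val_eq_sum_range d fun s => thetaEven τ (z + t.val / d) * thetaEven τ (s / d) +
      thetaOdd τ (z + t.val / d) * thetaOdd τ (s / d), ← Equiv.sum_comp (Equiv.addLeft t)]
  refine Finset.sum_congr rfl fun s _ => ?_
  have hadd : Equiv.addLeft t s = (((t.val : ℤ) + s.val : ℤ) : ZMod d) := by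
    push_cast
    simp
  have hsub : 2 • t - Equiv.addLeft t s = (((t.val : ℤ) - s.val : ℤ) : ZMod d) := by
    push_cast
    simp [two_mul]
  rw [hsub, hadd, thetaSample_intCast, thetaSample_intCast, ← jacobiTheta₂_add_mul_sub hτ]
  push_cast
  ring_nf

theorem intCast_mul_add_intCast_eq_zero_iff (hτ : 0 < τ.im) {c δ : ℤ} :
    (c : ℂ) * τ + δ = 0 ↔ c = 0 ∧ δ = 0 := by
  refine ⟨fun h => ?_, fun ⟨hc, hδ⟩ => by simp [hc, hδ]⟩
  have him := congrArg Complex.im h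
  rw [intCast_mul_add_intCast_im, zero_im, mul_eq_zero, or_iff_left hτ.ne'] at him
  obtain rfl : c = 0 := by exact_mod_cast him
  exact ⟨rfl, by simpa using h⟩

theorem thetaSample_ne_zero (hd1 : 1 < d) (hτ : 0 < τ.im) (z : ℂ) : thetaSample d τ z ≠ 0 := by
  intro h
  have h0 := congrFun h ((0 : ℤ) : ZMod d)
  have h1 := congrFun h ((1 : ℤ) : ZMod d)
  rw [thetaSample_intCast, Pi.zero_apply, jacobiTheta₂_eq_zero_iff hτ] at h0 h1
  obtain ⟨m, n, h0⟩ := h0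
  obtain ⟨m', n', h1⟩ := h1
  have hd0 : (d : ℂ) ≠ 0 := Nat.cast_ne_zero.mpr (NeZero.ne d)
  have hlattice : ((d * (n' - n) : ℤ) : ℂ) * τ + ((d * (m' - m) - 1 : ℤ) : ℂ) = 0 := by
    have hdiff : (1 : ℂ) / d = (m' - m) + (n' - n) * τ := by
      push_cast at h0 h1
      linear_combination h1 - h0
    rw [div_eq_iff hd0] at hdiff
    push_cast
    linear_combination -hdiff
  have hone := ((intCast_mul_add_intCast_eq_zero_iff hτ).mp hlattice).2
  have := Int.le_of_dvd one_pos (⟨m' - m, by linarith⟩ : (d : ℤ) ∣ 1)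
  omega

theorem IsThetaCritical.one_lt (hτ : 0 < τ.im) (h : IsThetaCritical lam d τ) : 1 < d := by
  by_contra hd
  obtain rfl : d = 1 := by
    have := NeZero.ne d
    omega
  refine (h ((1 + τ) / 2)).1 (funext fun l => ?_)
  obtain rfl : l = ((0 : ℤ) : ZMod 1) := Subsingleton.elim _ _
  rw [thetaSample_intCast]
  simpa using jacobiTheta₂_halfPeriod hτ

theorem isThetaCritical_iff_theta_constants (hd : Odd d) (hd1 : 1 < d) (hτ : 0 < τ.im) (lam : ℂ) :
    IsThetaCritical lam d τ ↔ d * thetaEven ((d : ℂ) ^ 2 * τ) 0 = lam * thetaEven τ 0 ∧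
      d * thetaOdd ((d : ℂ) ^ 2 * τ) 0 = lam * thetaOdd τ 0 := by
  have hsq (w : ℂ) : jacobiTheta₂ w τ ^ 2 =
      thetaEven τ w * thetaEven τ 0 + thetaOdd τ w * thetaOdd τ 0 := by
    rw [← jacobiTheta₂_add_mul_sub hτ, add_zero, sub_zero, sq]
  constructor
  · intro h
    have hrel (z : ℂ) :
        thetaEven τ z * (d * thetaEven ((d : ℂ) ^ 2 * τ) 0 - lam * thetaEven τ 0) +
          thetaOdd τ z * (d * thetaOdd ((d : ℂ) ^ 2 * τ) 0 - lam * thetaOdd τ 0) = 0 := by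
      have hz := (h z).2 0
      rw [sum_thetaSample hd hτ, thetaSample, hsq] at hz
      simp only [ZMod.val_zero, Nat.cast_zero, zero_div, add_zero] at hz
      linear_combination hz
    have hrel_zero := hrel 0
    have hrel_half := hrel (0 + 1 / 2)
    rw [thetaEven_add_half, thetaOdd_add_half] at hrel_half
    constructor
    · apply mul_left_cancel₀ (thetaEven_zero_ne_zero hτ)
      linear_combination (hrel_zero + hrel_half) / 2
    · apply mul_left_cancel₀ (thetaOdd_zero_ne_zero hτ)
      linear_combination (hrel_zero - hrel_half) / 2
  · rintro ⟨hE, hO⟩ z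
    refine ⟨thetaSample_ne_zero hd1 hτ z, fun t => ?_⟩
    rw [sum_thetaSample hd hτ, thetaSample, hsq, hE, hO]
    ring

theorem IsThetaCritical.conj (h : IsThetaCritical lam d τ) :
    IsThetaCritical (starRingEnd ℂ lam) d (-starRingEnd ℂ τ) := by
  intro z
  have hf : thetaSample d (-starRingEnd ℂ τ) z =
      fun l => starRingEnd ℂ (thetaSample d τ (starRingEnd ℂ z) l) := by
    funext l
    rw [thetaSample, thetaSample, jacobiTheta₂_conj, map_add, map_div₀, Complex.conj_conj,
      Complex.conj_natCast, Complex.conj_natCast]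
  obtain ⟨hne, hsum⟩ := h (starRingEnd ℂ z)
  rw [hf]
  refine ⟨fun hzero => hne (funext fun l => by simpa using congrFun hzero l), fun t => ?_⟩
  simpa [map_sum] using congrArg (starRingEnd ℂ) (hsum t)

end Criticality

section Multiplier

variable {d : ℕ} [NeZero d] {τ lam : ℂ} {α β c δ : ℤ}

theorem int_gcd_natAbs_eq_one (hdet : α * δ - β * c = 1) :
    Int.gcd |c| (δ.natAbs : ℤ) = 1 := by
  have h : IsCoprime c δ := ⟨-β, α, by linear_combination hdet⟩
  rw [Int.isCoprime_iff_gcd_eq_one] at h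
  simpa [Int.gcd, Int.natAbs_abs] using h

theorem isThetaCritical_iff_of_matrix (hd : Odd d) (hd1 : 1 < d) (hτ : 0 < τ.im)
    (hdet : α * δ - β * c = 1) (hc : 4 ∣ c) (hβ : 4 ∣ β) (hδ : δ % 4 = 1)
    (hfix : (d : ℂ) ^ 2 * τ * (c * τ + δ) = α * τ + β) (lam : ℂ) :
    IsThetaCritical lam d τ ↔ lam = (J(|c| | δ.natAbs) : ℂ) * (d * (c * τ + δ).sqrt) := by
  have hden : (c : ℂ) * τ + δ ≠ 0 := by
    rw [Ne, intCast_mul_add_intCast_eq_zero_iff hτ]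
    omega
  obtain ⟨hE, hO⟩ := thetaTransforms_of_det_eq_one hdet hc hδ τ hτ
  rw [← hfix, mul_div_cancel_right₀ _ hden] at hE hO
  rw [I_zpow_eq_of_four_dvd (n := 0) (by simpa using hβ), zpow_zero, one_mul] at hO
  rw [isThetaCritical_iff_theta_constants hd hd1 hτ, hE, hO]
  constructor
  · rintro ⟨h, -⟩
    apply mul_right_cancel₀ (thetaEven_zero_ne_zero hτ)
    linear_combination -h
  · rintro rfl
    constructor <;> ring

theorem IsThetaCritical.exists_matrix (hd : Odd d) (hτ : 0 < τ.im) (h : IsThetaCritical lam d τ) :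
    ∃ α β c δ : ℤ, α * δ - β * c = 1 ∧ 4 ∣ c ∧ 4 ∣ β ∧ δ % 4 = 1 ∧
      (d : ℂ) ^ 2 * τ * (c * τ + δ) = α * τ + β ∧ (d : ℂ) ^ 2 * (c * τ + δ) = lam ^ 2 := by
  have hd1 := h.one_lt hτ
  have hd0 : (d : ℂ) ≠ 0 := Nat.cast_ne_zero.mpr (NeZero.ne d)
  obtain ⟨hE, hO⟩ := (isThetaCritical_iff_theta_constants hd hd1 hτ lam).mp h
  obtain ⟨α, β, c, δ, hdet, hc, hβ, hδ, hfix⟩ :=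
    exists_gamma_four_of_proportional (natCast_sq_mul_im_pos hτ d) hτ (κ := lam / d)
      (by field_simp; linear_combination hE) (by field_simp; linear_combination hO)
  refine ⟨α, β, c, δ, hdet, hc, hβ, hδ, hfix, ?_⟩
  have hJ : (J(|c| | δ.natAbs) : ℂ) ^ 2 = 1 := by
    exact_mod_cast jacobiSym.sq_one (int_gcd_natAbs_eq_one hdet)
  rw [(isThetaCritical_iff_of_matrix hd hd1 hτ hdet hc hβ hδ hfix lam).mp h, mul_pow, mul_pow, hJ,
    csqrt_sq, one_mul]

end Multiplier

section Trace

variable {d : ℕ} {τ : ℂ} {α β c δ : ℤ}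

/- Both sides say that `(τ, 1)` is an eigenvector, with eigenvalue `D (c τ + δ)`, of the matrix
with rows `(α, β)` and `(D c, D δ)`, which has trace `α + D δ` and determinant `D`. -/
theorem fixed_iff_quadratic {K : Type*} [Field K] {D α β c δ τ : K} (hD : D ≠ 0) (hc : c ≠ 0)
    (hdet : α * δ - β * c = 1) :
    D * τ * (c * τ + δ) = α * τ + β ↔
      (D * (c * τ + δ)) ^ 2 - (α + D * δ) * (D * (c * τ + δ)) + D = 0 := by
  constructor
  · intro h
    linear_combination D * c * h - D * hdet
  · intro h
    apply mul_left_cancel₀ (mul_ne_zero hD hc)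
    linear_combination h + D * hdet

theorem bottom_left_ne_zero (hτ : 0 < τ.im) (hd1 : 1 < d) (hdet : α * δ - β * c = 1)
    (hfix : (d : ℂ) ^ 2 * τ * (c * τ + δ) = α * τ + β) : c ≠ 0 := by
  rintro rfl
  have hlin : ((d ^ 2 * δ - α : ℤ) : ℂ) * τ + ((-β : ℤ) : ℂ) = 0 := by
    push_cast at hfix ⊢
    linear_combination hfix
  have hα := ((intCast_mul_add_intCast_eq_zero_iff hτ).mp hlin).1
  have hdvd : (d : ℤ) * (d * δ ^ 2) = 1 := by linear_combination hdet + δ * hα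
  rcases Int.eq_one_or_neg_one_of_mul_eq_one hdvd with h | h <;> omega

theorem re_im_of_real_quadratic {T D : ℝ} {μ : ℂ} (h : μ ^ 2 - T * μ + D = 0) (him : μ.im ≠ 0) :
    2 * μ.re = T ∧ 4 * μ.im ^ 2 = 4 * D - T ^ 2 := by
  have hre := congrArg Complex.re h
  have hi := congrArg Complex.im h
  simp only [sq, add_re, sub_re, mul_re, ofReal_re, ofReal_im, add_im, sub_im, mul_im, zero_re,
    zero_im, zero_mul, sub_zero, add_zero] at hre hi
  obtain rfl : 2 * μ.re = T := mul_right_cancel₀ him (by linear_combination hi)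
  exact ⟨rfl, by linear_combination -4 * hre⟩

theorem natCast_sq_mul_intCast_im (d : ℕ) (c δ : ℤ) (τ : ℂ) :
    ((d : ℂ) ^ 2 * (c * τ + δ)).im = d ^ 2 * c * τ.im := by
  rw [← Nat.cast_pow, ← ofReal_natCast, im_ofReal_mul, intCast_mul_add_intCast_im]
  push_cast
  ring

theorem multiplier_re_im (hτ : 0 < τ.im) (hd1 : 1 < d) (hdet : α * δ - β * c = 1)
    (hfix : (d : ℂ) ^ 2 * τ * (c * τ + δ) = α * τ + β) {μ : ℂ}
    (hμ : (d : ℂ) ^ 2 * (c * τ + δ) = μ) :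
    μ.im ≠ 0 ∧ 2 * μ.re = ((α + d ^ 2 * δ : ℤ) : ℝ) ∧
      4 * μ.im ^ 2 = 4 * d ^ 2 - ((α + d ^ 2 * δ : ℤ) : ℝ) ^ 2 := by
  have hc := bottom_left_ne_zero hτ hd1 hdet hfix
  have hd0 : (d : ℝ) ≠ 0 := Nat.cast_ne_zero.mpr (by omega)
  have him : μ.im ≠ 0 := by
    rw [← hμ, natCast_sq_mul_intCast_im]
    exact mul_ne_zero (mul_ne_zero (pow_ne_zero 2 hd0) (Int.cast_ne_zero.mpr hc)) hτ.ne'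
  have hquad := (fixed_iff_quadratic (pow_ne_zero 2 (by exact_mod_cast hd0))
    (Int.cast_ne_zero.mpr hc) (by exact_mod_cast hdet)).mp hfix
  rw [hμ] at hquad
  exact ⟨him, re_im_of_real_quadratic (by push_cast; exact hquad) him⟩

end Trace

section AdmissiblePairs

theorem lambdaZero_re (a b : ℕ) : (lambdaZero a b).re = √(a : ℝ) := by
  simp [lambdaZero]

theorem lambdaZero_sq (a b : ℕ) :
    lambdaZero a b ^ 2 = a - b + 2 * I * (√((a : ℝ) * (b : ℝ)) : ℂ) := by
  have ha : ((√(a : ℝ) : ℝ) : ℂ) ^ 2 = a := by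
    rw [← ofReal_pow, Real.sq_sqrt (Nat.cast_nonneg a), ofReal_natCast]
  have hb : ((√(b : ℝ) : ℝ) : ℂ) ^ 2 = b := by
    rw [← ofReal_pow, Real.sq_sqrt (Nat.cast_nonneg b), ofReal_natCast]
  rw [lambdaZero, Real.sqrt_mul (Nat.cast_nonneg a), ofReal_mul]
  linear_combination ha + I ^ 2 * hb + (b : ℂ) * I_sq

theorem lambdaZero_sq_re (a b : ℕ) : (lambdaZero a b ^ 2).re = a - b := by
  rw [lambdaZero_sq]
  simp

theorem lambdaZero_sq_im (a b : ℕ) : (lambdaZero a b ^ 2).im = 2 * √((a : ℝ) * b) := by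
  rw [lambdaZero_sq]
  simp

theorem lambdaZero_quadratic (a b : ℕ) :
    (lambdaZero a b ^ 2) ^ 2 - 2 * (a - b) * lambdaZero a b ^ 2 + (a + b : ℂ) ^ 2 = 0 := by
  have h : ((√((a : ℝ) * b) : ℝ) : ℂ) ^ 2 = a * b := by
    rw [← ofReal_pow, Real.sq_sqrt (by positivity)]
    push_cast
    rfl
  rw [lambdaZero_sq]
  linear_combination 4 * I ^ 2 * h + 4 * (a : ℂ) * b * I_sq

variable {d a b : ℕ}

theorem natCast_mul_csqrt_eq_lambdaZero [NeZero d] {w : ℂ} (ha : 0 < a)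
    (hw : (d : ℂ) ^ 2 * w = lambdaZero a b ^ 2) : d * w.sqrt = lambdaZero a b := by
  have hd0 : (d : ℂ) ≠ 0 := Nat.cast_ne_zero.mpr (NeZero.ne d)
  have hd : (0 : ℝ) < d := Nat.cast_pos.mpr (NeZero.pos d)
  have hsq : (lambdaZero a b / d) ^ 2 = w := by
    rw [div_pow, ← hw]
    field_simp
  rw [csqrt_eq_of_sq_eq hsq, mul_div_cancel₀ _ hd0]
  rw [← ofReal_natCast, div_ofReal_re, lambdaZero_re]
  positivity

theorem IsAdmissiblePair.one_lt (h : IsAdmissiblePair d a b) : 1 < d := by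
  obtain ⟨ha, hb, hab, -⟩ := h
  omega

theorem IsAdmissiblePair.lambdaZero_sq_im_pos (h : IsAdmissiblePair d a b) :
    0 < (lambdaZero a b ^ 2).im := by
  have ha : (0 : ℝ) < a := Nat.cast_pos.mpr h.1
  have hb : (0 : ℝ) < b := Nat.cast_pos.mpr h.2.1
  rw [lambdaZero_sq_im]
  positivity

variable [NeZero d]

theorem four_mul_tauZero_add_one (a b : ℕ) :
    (d : ℂ) ^ 2 * (4 * tauZero d a b + 1) = lambdaZero a b ^ 2 := by
  have hd : (d : ℂ) ≠ 0 := Nat.cast_ne_zero.mpr (NeZero.ne d)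
  rw [lambdaZero_sq, tauZero]
  field_simp
  ring

theorem IsAdmissiblePair.tauZero_im_pos (h : IsAdmissiblePair d a b) :
    0 < (tauZero d a b).im := by
  have him := h.lambdaZero_sq_im_pos
  have hlin := natCast_sq_mul_intCast_im d 4 1 (tauZero d a b)
  push_cast at hlin
  rw [← four_mul_tauZero_add_one (d := d), hlin] at him
  exact pos_of_mul_pos_right him (by positivity)

theorem IsAdmissiblePair.div_im_pos (h : IsAdmissiblePair d a b) (k : ℤ) {p : ℕ} (hp : 0 < p) :
    0 < (((k : ℂ) + tauZero d a b) / (p : ℂ)).im := by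
  rw [← ofReal_natCast, div_ofReal_im]
  simpa using div_pos h.tauZero_im_pos (Nat.cast_pos.mpr hp)

theorem norm_intCast_add_tauZero_sq (a b : ℕ) (k : ℤ) :
    (4 * d ^ 2) ^ 2 * ‖(k : ℂ) + tauZero d a b‖ ^ 2 =
      (d ^ 2 * (4 * k - 1) + (a - b) : ℝ) ^ 2 + 4 * (a * b) := by
  have hlin : (4 * d ^ 2 : ℝ) * (k + tauZero d a b) =
      ((d ^ 2 * (4 * k - 1) : ℝ) : ℂ) + lambdaZero a b ^ 2 := by
    rw [← four_mul_tauZero_add_one (d := d)]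
    push_cast
    ring
  have hsqrt := Real.sq_sqrt (show (0 : ℝ) ≤ a * b by positivity)
  rw [← sq_abs (4 * d ^ 2 : ℝ), ← Real.norm_eq_abs, ← Complex.norm_real, ← mul_pow, ← norm_mul,
    hlin, ← Complex.normSq_eq_norm_sq, Complex.normSq_apply, add_re, add_im, ofReal_re,
    ofReal_im, lambdaZero_sq_re, lambdaZero_sq_im]
  linear_combination 4 * hsqrt

theorem isNk_iff (hab : a + b = d) (k N : ℤ) :
    IsNk d a b k N ↔ 16 * N = d ^ 2 * (4 * k - 1) ^ 2 + 2 * (4 * k - 1) * (a - b) + 1 := by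
  have hd : (d : ℝ) ≠ 0 := Nat.cast_ne_zero.mpr (NeZero.ne d)
  have hab' : (a : ℝ) + b = d := by exact_mod_cast hab
  have hnorm : 16 * (d ^ 2 * ‖(k : ℂ) + tauZero d a b‖ ^ 2) =
      (d ^ 2 * (4 * k - 1) ^ 2 + 2 * (4 * k - 1) * (a - b) + 1 : ℝ) := by
    apply mul_left_cancel₀ (pow_ne_zero 2 hd)
    linear_combination norm_intCast_add_tauZero_sq (d := d) a b k + (a + b + d) * hab'
  rw [IsNk, ← @Int.cast_inj ℝ]
  push_cast
  rw [← hnorm]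
  exact (mul_right_inj' (by norm_num)).symm

theorem odd_succ_sq_div_four (e : ℕ) : (2 * e + 1 + 1) ^ 2 / 4 = (e + 1) ^ 2 := by
  rw [show (2 * e + 1 + 1) ^ 2 = (e + 1) ^ 2 * 4 by ring, Nat.mul_div_cancel _ (by norm_num)]

theorem IsAdmissiblePair.exists_isNk (hd : Odd d) (h : IsAdmissiblePair d a b) (k : ℤ) :
    ∃ N : ℤ, IsNk d a b k N := by
  obtain ⟨-, -, hab, hmod⟩ := h
  obtain ⟨e, rfl⟩ := hd
  rw [odd_succ_sq_div_four, Nat.modEq_iff_dvd] at hmod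
  obtain ⟨j, hj⟩ := hmod
  push_cast at hj
  refine ⟨k ^ 2 * (2 * e + 1) ^ 2 - k * (2 * e + 1) * (e + 1) + k * (e + 1) ^ 2 - j * (4 * k - 1),
    (isNk_iff hab k _).mpr ?_⟩
  have hb : (b : ℤ) = 2 * e + 1 - a := by omega
  rw [hb]
  push_cast
  linear_combination 4 * (4 * k - 1) * hj

end AdmissiblePairs

section CriticalParameters

variable {d : ℕ} [NeZero d] {a b : ℕ} {lam τ : ℂ}

theorem jacobiSym_four_mul_eq_signSymbol (k : ℤ) (p : ℕ) :
    J(|(4 * p : ℤ)| | (1 - 4 * k).natAbs) = signSymbol k p := by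
  have hodd : Odd (1 - 4 * k).natAbs := Int.natAbs_odd.mpr (Int.odd_iff.mpr (by omega))
  rw [signSymbol, ← Int.natAbs_neg (4 * k - 1), neg_sub, abs_of_nonneg (by positivity),
    jacobiSym.mul_left, jacobiSym.at_four hodd, one_mul]

theorem IsAdmissiblePair.isThetaCritical_div_iff (hd : Odd d) (h : IsAdmissiblePair d a b) {k : ℤ}
    {p : ℕ} {N : ℤ} (hp : 0 < p) (hN : IsNk d a b k N) (hpN : (p : ℤ) ∣ N) :
    (signSymbol k p = 1 ∨ signSymbol k p = -1) ∧
      ∀ lam : ℂ, IsThetaCritical lam d (((k : ℂ) + tauZero d a b) / (p : ℂ)) ↔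
        lam = (signSymbol k p : ℂ) * lambdaZero a b := by
  have hab := h.2.2.1
  rw [isNk_iff hab] at hN
  obtain ⟨r, rfl⟩ := hpN
  have hdet : (2 * (a - b) - d ^ 2 * (1 - 4 * k)) * (1 - 4 * k) - -4 * r * (4 * p) = 1 := by
    linear_combination hN
  rw [← jacobiSym_four_mul_eq_signSymbol]
  refine ⟨jacobiSym.eq_one_or_neg_one (int_gcd_natAbs_eq_one hdet), fun lam => ?_⟩
  have hτ := h.div_im_pos k hp
  have hp0 : (p : ℂ) ≠ 0 := Nat.cast_ne_zero.mpr hp.ne'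
  have hd0 : (d : ℂ) ^ 2 ≠ 0 := pow_ne_zero 2 (Nat.cast_ne_zero.mpr (NeZero.ne d))
  set τ : ℂ := ((k : ℂ) + tauZero d a b) / (p : ℂ) with hτdef
  have hμ : (d : ℂ) ^ 2 * (((4 * p : ℤ) : ℂ) * τ + ((1 - 4 * k : ℤ) : ℂ)) = lambdaZero a b ^ 2 := by
    rw [← four_mul_tauZero_add_one (d := d), hτdef]
    push_cast
    field_simp
    ring
  have hfix : (d : ℂ) ^ 2 * τ * (((4 * p : ℤ) : ℂ) * τ + ((1 - 4 * k : ℤ) : ℂ)) =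
      ((2 * (a - b) - d ^ 2 * (1 - 4 * k) : ℤ) : ℂ) * τ + ((-4 * r : ℤ) : ℂ) := by
    rw [fixed_iff_quadratic hd0 (by simpa using hp0) (by exact_mod_cast hdet), hμ]
    have hquad := lambdaZero_quadratic a b
    rw [← Nat.cast_add, hab] at hquad
    push_cast
    linear_combination hquad
  rw [isThetaCritical_iff_of_matrix hd h.one_lt hτ hdet ⟨p, rfl⟩ ⟨-r, by ring⟩ (by omega) hfix,
    natCast_mul_csqrt_eq_lambdaZero h.1 hμ]

theorem IsAdmissiblePair.isThetaCritical_tauZero (hd : Odd d) (h : IsAdmissiblePair d a b) :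
    IsThetaCritical (lambdaZero a b) d (tauZero d a b) := by
  obtain ⟨N, hN⟩ := h.exists_isNk hd 0
  have hcrit := ((h.isThetaCritical_div_iff hd one_pos hN (by simp)).2 (lambdaZero a b)).mpr
    (by simp [signSymbol])
  simpa using hcrit

theorem IsThetaCritical.exists_eq_div (hd : Odd d) (hab : IsAdmissiblePair d a b) (hτ : 0 < τ.im)
    (h : IsThetaCritical lam d τ) (hlam : lam ^ 2 = lambdaZero a b ^ 2) :
    ∃ (k : ℤ) (p : ℕ) (N : ℤ), 0 < p ∧ IsNk d a b k N ∧ (p : ℤ) ∣ N ∧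
      τ = ((k : ℂ) + tauZero d a b) / (p : ℂ) := by
  have hd0 : (d : ℂ) ^ 2 ≠ 0 := pow_ne_zero 2 (Nat.cast_ne_zero.mpr (NeZero.ne d))
  obtain ⟨α, β, c, δ, hdet, ⟨p, rfl⟩, ⟨r, rfl⟩, hδ, hfix, hsq⟩ := h.exists_matrix hd hτ
  rw [hlam] at hsq
  have htrace : 2 * ((a : ℤ) - b) = α + d ^ 2 * δ := by
    have hre := (multiplier_re_im hτ hab.one_lt hdet hfix hsq).2.1
    rw [lambdaZero_sq_re] at hre
    exact_mod_cast hre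
  have hp : 0 < p := by
    have him := hab.lambdaZero_sq_im_pos
    rw [← hsq, natCast_sq_mul_intCast_im, mul_assoc] at him
    have h4p : (0 : ℝ) < ((4 * p : ℤ) : ℝ) :=
      pos_of_mul_pos_left (pos_of_mul_pos_right him (by positivity)) hτ.le
    have : 0 < 4 * p := by exact_mod_cast h4p
    omega
  lift p to ℕ using hp.le
  obtain ⟨k, rfl⟩ : ∃ k, δ = 1 - 4 * k := ⟨-(δ / 4), by omega⟩
  refine ⟨k, p, p * -r, by exact_mod_cast hp, (isNk_iff hab.2.2.1 _ _).mpr ?_, ⟨-r, rfl⟩, ?_⟩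
  · linear_combination hdet + (1 - 4 * k) * htrace
  · rw [← four_mul_tauZero_add_one (d := d)] at hsq
    have hlin := mul_left_cancel₀ hd0 hsq
    rw [eq_div_iff (by exact_mod_cast hp.ne')]
    push_cast at hlin
    linear_combination hlin / 4

theorem IsAdmissiblePair.isThetaCritical_or_neg_iff (hd : Odd d) (h : IsAdmissiblePair d a b)
    (hτ : 0 < τ.im) :
    (IsThetaCritical (lambdaZero a b) d τ ∨ IsThetaCritical (-lambdaZero a b) d τ) ↔
      ∃ (k : ℤ) (p : ℕ) (N : ℤ), 0 < p ∧ IsNk d a b k N ∧ (p : ℤ) ∣ N ∧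
        τ = ((k : ℂ) + tauZero d a b) / (p : ℂ) := by
  constructor
  · rintro (hcrit | hcrit)
    · exact hcrit.exists_eq_div hd h hτ rfl
    · exact hcrit.exists_eq_div hd h hτ (neg_sq _)
  · rintro ⟨k, p, N, hp, hN, hpN, rfl⟩
    obtain ⟨hs, hiff⟩ := h.isThetaCritical_div_iff hd hp hN hpN
    rw [hiff, hiff]
    rcases hs with hs | hs <;> simp [hs]

end CriticalParameters

section CriticalValues

variable {d : ℕ}

theorem trace_modEq_of_gamma_four {α β c δ : ℤ} (hd : Odd d) (hdet : α * δ - β * c = 1)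
    (hc : 4 ∣ c) (hβ : 4 ∣ β) (hδ : δ % 4 = 1) : α + d ^ 2 * δ ≡ d ^ 2 + 1 [ZMOD 16] := by
  obtain ⟨e, rfl⟩ := hd
  obtain ⟨p, rfl⟩ := hc
  obtain ⟨r, rfl⟩ := hβ
  obtain ⟨y, rfl⟩ : ∃ y, δ = 4 * y + 1 := ⟨δ / 4, by omega⟩
  refine Int.modEq_iff_dvd.mpr ⟨y * (4 * r * p - α * y - e * (e + 1)) - r * p, ?_⟩
  push_cast
  linear_combination (4 * y - 1) * hdet

theorem exists_isAdmissiblePair_of_trace {T : ℤ} (hd : Odd d) (hmod : T ≡ d ^ 2 + 1 [ZMOD 16])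
    (hT : T ^ 2 < 4 * d ^ 2) : ∃ a b : ℕ, IsAdmissiblePair d a b ∧ T = 2 * (a - b) := by
  obtain ⟨hlower, hupper⟩ :=
    abs_lt_of_sq_lt_sq' (hT.trans_eq (by ring)) (by positivity : 0 ≤ 2 * (d : ℤ))
  obtain ⟨e, rfl⟩ := hd
  obtain ⟨j, hj⟩ := Int.modEq_iff_dvd.mp hmod
  obtain ⟨a, ha⟩ : ∃ a : ℕ, (a : ℤ) = (e + 1) ^ 2 - 4 * j := by
    refine ⟨((e + 1) ^ 2 - 4 * j).toNat, Int.toNat_of_nonneg ?_⟩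
    push_cast at *
    linarith
  have hTa : T = 4 * a - 2 * (2 * e + 1) := by
    push_cast at hj
    linear_combination -hj - 4 * ha
  push_cast at hlower hupper
  refine ⟨a, 2 * e + 1 - a, ⟨by omega, by omega, by omega, ?_⟩, by omega⟩
  rw [odd_succ_sq_div_four, Nat.modEq_iff_dvd]
  exact ⟨j, by push_cast; linear_combination -ha⟩

theorem exists_sign_eq_mul_sqrt {x a : ℝ} (h : x ^ 2 = a) :
    ∃ s : ℂ, (s = 1 ∨ s = -1) ∧ (x : ℂ) = s * (√a : ℂ) := by
  rw [← h, Real.sqrt_sq_eq_abs]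
  rcases abs_choice x with hx | hx <;> rw [hx]
  · exact ⟨1, .inl rfl, (one_mul _).symm⟩
  · exact ⟨-1, .inr rfl, by simp⟩

theorem exists_signs_of_sq_re_im {a b : ℝ} {z : ℂ} (ha : 0 ≤ a) (hb : 0 ≤ b)
    (hre : (z ^ 2).re = a - b) (him : (z ^ 2).im ^ 2 = 4 * (a * b)) :
    ∃ s t : ℂ, (s = 1 ∨ s = -1) ∧ (t = 1 ∨ t = -1) ∧
      z = s * (√a : ℂ) + t * (I * (√b : ℂ)) := by
  rw [sq, mul_re] at hre
  rw [sq z, mul_im] at him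
  have hnorm : z.re ^ 2 + z.im ^ 2 = a + b := by
    apply (sq_eq_sq₀ (by positivity) (by positivity)).mp
    linear_combination him + (z.re * z.re - z.im * z.im + a - b) * hre
  obtain ⟨s, hs, hzs⟩ := exists_sign_eq_mul_sqrt (x := z.re) (a := a) (by linarith)
  obtain ⟨t, ht, hzt⟩ := exists_sign_eq_mul_sqrt (x := z.im) (a := b) (by linarith)
  refine ⟨s, t, hs, ht, ?_⟩
  rw [← re_add_im z, hzs, hzt]
  ring

theorem IsThetaCritical.exists_isAdmissiblePair [NeZero d] (hd : Odd d) {lam τ : ℂ}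
    (hτ : 0 < τ.im) (h : IsThetaCritical lam d τ) :
    ∃ a b : ℕ, IsAdmissiblePair d a b ∧
      ∃ s t : ℂ, (s = 1 ∨ s = -1) ∧ (t = 1 ∨ t = -1) ∧
        lam = s * (√(a : ℝ) : ℂ) + t * (I * (√(b : ℝ) : ℂ)) := by
  obtain ⟨α, β, c, δ, hdet, hc, hβ, hδ, hfix, hsq⟩ := h.exists_matrix hd hτ
  obtain ⟨him, hre, him_sq⟩ := multiplier_re_im hτ (h.one_lt hτ) hdet hfix hsq
  have hdisc : (α + d ^ 2 * δ) ^ 2 < 4 * (d : ℤ) ^ 2 := by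
    have : (0 : ℝ) < (lam ^ 2).im ^ 2 := by positivity
    have hdisc' : ((α + d ^ 2 * δ : ℤ) : ℝ) ^ 2 < 4 * d ^ 2 := by linarith
    exact_mod_cast hdisc'
  obtain ⟨a, b, hab, htrace⟩ :=
    exists_isAdmissiblePair_of_trace hd (trace_modEq_of_gamma_four hd hdet hc hβ hδ) hdisc
  have hd' : (a : ℝ) + b = d := by exact_mod_cast hab.2.2.1
  rw [htrace] at hre him_sq
  push_cast at hre him_sq
  refine ⟨a, b, hab, exists_signs_of_sq_re_im a.cast_nonneg b.cast_nonneg (by linarith) ?_⟩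
  rw [← hd'] at him_sq
  linear_combination him_sq / 4

end CriticalValues

theorem proposition3p2 (d : ℕ) [NeZero d] (hd : Odd d) :
    -- (a), (c), (d), for each admissible pair
    (∀ a b : ℕ, IsAdmissiblePair d a b →
      -- (a)
      (0 < (tauZero d a b).im ∧ IsThetaCritical (lambdaZero a b) d (tauZero d a b)) ∧
      -- (c)
      (∀ k : ℤ, ∃ N : ℤ, IsNk d a b k N) ∧
      (∀ τ : ℂ, 0 < τ.im →
        ((IsThetaCritical (lambdaZero a b) d τ ∨ IsThetaCritical (-lambdaZero a b) d τ) ↔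
          ∃ (k : ℤ) (p : ℕ) (N : ℤ), 0 < p ∧ IsNk d a b k N ∧ (p : ℤ) ∣ N ∧
            τ = ((k : ℂ) + tauZero d a b) / (p : ℂ))) ∧
      -- (d)
      (∀ (k : ℤ) (p : ℕ) (N : ℤ), 0 < p → IsNk d a b k N → (p : ℤ) ∣ N →
        (signSymbol k p = 1 ∨ signSymbol k p = -1) ∧
        ∀ lam : ℂ, IsThetaCritical lam d (((k : ℂ) + tauZero d a b) / (p : ℂ)) ↔
          lam = (signSymbol k p : ℂ) * lambdaZero a b)) ∧
    -- (b)
    (∀ lam τ : ℂ, 0 < τ.im → IsThetaCritical lam d τ →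
      ∃ a b : ℕ, IsAdmissiblePair d a b ∧
        ∃ s t : ℂ, (s = 1 ∨ s = -1) ∧ (t = 1 ∨ t = -1) ∧
          lam = s * (√(a : ℝ) : ℂ) + t * (I * (√(b : ℝ) : ℂ))) ∧
    -- complex conjugation, which reduces the remaining signs in (b) to those in (c)
    (∀ lam τ : ℂ, 0 < τ.im →
      (IsThetaCritical lam d τ ↔
        IsThetaCritical (starRingEnd ℂ lam) d (-starRingEnd ℂ τ))) := by
  refine ⟨fun a b hab => ⟨⟨hab.tauZero_im_pos, hab.isThetaCritical_tauZero hd⟩,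
      hab.exists_isNk hd, fun τ hτ => hab.isThetaCritical_or_neg_iff hd hτ,
      fun k p N hp hN hpN => hab.isThetaCritical_div_iff hd hp hN hpN⟩,
    fun lam τ hτ h => h.exists_isAdmissiblePair hd hτ,
    fun lam τ _ => ⟨fun h => h.conj, fun h => ?_⟩⟩
  simpa using h.conj
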